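/- Let $k$ be a field, let $\Sigma$ be a fan in $N_{\mathbb R}$, where $N\cong\mathbb Z^n$ (a finite nonempty set of strongly convex rational polyhedral cones, closed under faces, any two of which meet in a common face), let $M=\operatorname{Hom}(N,\mathbb Z)$, and let $X=X_\Sigma$ be the toric variety over $k$ obtained by gluing the affine charts $U_\sigma=\operatorname{Spec} k[\sigma^\vee\cap M]$, $\sigma\in\Sigma$, along the open subsets $U_{\sigma\cap\tau}$. Let the torus $T=\operatorname{Spec} k[M]$ act on $X$ in the usual way, by $\chi^m\mapsto \chi^m\otimes\chi^m$ on the charts. Let $\Delta=X\setminus U_{\{0\}}$ be the complement of the open torus and let $D_1,\dots,D_r$ be the irreducible components of $\Delta$. Assume that $X$ is smooth over $k$. Let $I\subset\mathcal O_X$ be a quasi-coherent ideal sheaf. Then $I$ is toric if and only if it is toroidal, where - $I$ is \emph{toric} if it is $T$-invariant, that is, its inverse image ideal sheaves under the action morphism $T\times_k X\to X$ and under the second projection $T\times_k X\to X$ are equal; - $I$ is \emph{toroidal} if $X$ is covered by open sets $U_j$ such that, for every $j$, $$I|_{U_j}=\sum_s \mathcal O_{U_j}\Bigl(-\sum_i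 m_{ijs}\,D_i|_{U_j}\Bigr)$$ for a suitable (possibly empty) family of exponents $m_{ijs}\in\mathbb N$. -/

import Mathlib

open CategoryTheory CategoryTheory.Limits AlgebraicGeometry TopologicalSpace TensorProduct

universe u

noncomputable section

namespace Toric

/-! ### Cones and fans -/

/-- The pairing `⟨m, v⟩` of a character `m ∈ M = ℤⁿ` with a vector `v ∈ N_ℝ = ℝⁿ`. -/
def pairing {n : ℕ} (m : Fin n → ℤ) (v : Fin n → ℝ) : ℝ := ∑ i, (m i : ℝ) * v i

lemma pairing_zero {n : ℕ} (v : Fin n → ℝ) : pairing 0 v = 0 := by simp [pairing]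

lemma pairing_add {n : ℕ} (m m' : Fin n → ℤ) (v : Fin n → ℝ) :
    pairing (m + m') v = pairing m v + pairing m' v := by
  simp [pairing, add_mul, Finset.sum_add_distrib]

/-- The monoid `σ^∨ ∩ M` of characters that are nonnegative on the cone `σ`. -/
def dualMonoid {n : ℕ} (σ : PointedCone ℝ (Fin n → ℝ)) : AddSubmonoid (Fin n → ℤ) where
  carrier := {m | ∀ v ∈ σ, 0 ≤ pairing m v}
  zero_mem' v _ := (pairing_zero v).ge
  add_mem' {a b} ha hb v hv := by
    rw [pairing_add]
    exact add_nonneg (ha v hv) (hb v hv)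

lemma dualMonoid_anti {n : ℕ} {σ τ : PointedCone ℝ (Fin n → ℝ)} (h : σ ≤ τ) :
    dualMonoid τ ≤ dualMonoid σ := fun _ hm v hv => hm v (h hv)

/-- `τ` is a face of the rational cone `σ`: it is cut out of `σ` by a supporting hyperplane
`⟨m, ·⟩ = 0`, where `m ∈ σ^∨ ∩ M`. -/
def IsFace {n : ℕ} (τ σ : PointedCone ℝ (Fin n → ℝ)) : Prop :=
  ∃ m ∈ dualMonoid σ, ∀ v, v ∈ τ ↔ v ∈ σ ∧ pairing m v = 0

/-- `σ` is a rational polyhedral cone: it is generated by finitely many vectors of the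
lattice `N = ℤⁿ`. -/
def IsRationalPolyhedral {n : ℕ} (σ : PointedCone ℝ (Fin n → ℝ)) : Prop :=
  ∃ s : Finset (Fin n → ℤ), σ = PointedCone.hull ℝ ((fun w i => (w i : ℝ)) '' (s : Set (Fin n → ℤ)))

/-- A fan in `N_ℝ = ℝⁿ`: a finite nonempty collection of strongly convex rational polyhedral
cones, closed under taking faces, such that any two cones meet in a common face.
(Since every strongly convex cone has the face `{0}`, nonemptiness means that `{0}` belongs
to the fan.) -/
structure Fan (n : ℕ) where
  /-- The cones of the fan. -/
  cones : Set (PointedCone ℝ (Fin n → ℝ))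
  finite : cones.Finite
  rational : ∀ σ ∈ cones, IsRationalPolyhedral σ
  stronglyConvex : ∀ σ ∈ cones, (σ : ConvexCone ℝ (Fin n → ℝ)).Salient
  bot_mem : ⊥ ∈ cones
  face_mem : ∀ σ ∈ cones, ∀ τ, IsFace τ σ → τ ∈ cones
  inter_face : ∀ σ ∈ cones, ∀ τ ∈ cones, IsFace (σ ⊓ τ) σ

/-! ### Affine charts -/

variable (k : Type u) [Field k] {n : ℕ}

/-- The coordinate ring `k[σ^∨ ∩ M]` of the affine chart of `σ`. -/
abbrev CoordRing (σ : PointedCone ℝ (Fin n → ℝ)) : Type u := AddMonoidAlgebra k (dualMonoid σ)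

/-- The inclusion `k[τ^∨ ∩ M] → k[σ^∨ ∩ M]` for `σ ⊆ τ`. -/
def coordRingMap {σ τ : PointedCone ℝ (Fin n → ℝ)} (h : σ ≤ τ) :
    CoordRing k τ →ₐ[k] CoordRing k σ :=
  AddMonoidAlgebra.mapDomainAlgHom k k (AddSubmonoid.inclusion (dualMonoid_anti h))

/-- The affine toric variety `U_σ = Spec k[σ^∨ ∩ M]`. -/
abbrev chart (σ : PointedCone ℝ (Fin n → ℝ)) : Scheme.{u} := Spec (CommRingCat.of (CoordRing k σ))

/-- The morphism `U_σ ⟶ U_τ` for `σ ⊆ τ`. -/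
def chartMap {σ τ : PointedCone ℝ (Fin n → ℝ)} (h : σ ≤ τ) : chart k σ ⟶ chart k τ :=
  Spec.map (CommRingCat.ofHom (coordRingMap k h).toRingHom)

/-- The structure morphism `U_σ ⟶ Spec k`. -/
abbrev chartToSpec (σ : PointedCone ℝ (Fin n → ℝ)) : chart k σ ⟶ Spec (CommRingCat.of k) :=
  Spec.map (CommRingCat.ofHom (algebraMap k (CoordRing k σ)))

/-! ### Charts of faces are principal open subsets -/

lemma pairing_add_right {n : ℕ} (m : Fin n → ℤ) (v w : Fin n → ℝ) :
    pairing m (v + w) = pairing m v + pairing m w := by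
  simp [pairing, mul_add, Finset.sum_add_distrib]

lemma pairing_smul_right {n : ℕ} (m : Fin n → ℤ) (c : ℝ) (v : Fin n → ℝ) :
    pairing m (c • v) = c * pairing m v := by
  simp only [pairing, Pi.smul_apply, smul_eq_mul, Finset.mul_sum]
  exact Finset.sum_congr rfl fun i _ => by ring

lemma pairing_nsmul {n : ℕ} (N : ℕ) (m : Fin n → ℤ) (v : Fin n → ℝ) :
    pairing (N • m) v = N * pairing m v := by
  simp [pairing, Finset.mul_sum, mul_assoc]

lemma exists_nsmul_add_mem {n : ℕ} {σ τ : PointedCone ℝ (Fin n → ℝ)} (hτ : IsRationalPolyhedral τ)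
    {m : Fin n → ℤ} (hm : m ∈ dualMonoid τ) (hσ : ∀ v, v ∈ σ ↔ v ∈ τ ∧ pairing m v = 0)
    {w : Fin n → ℤ} (hw : w ∈ dualMonoid σ) : ∃ N : ℕ, w + N • m ∈ dualMonoid τ := by
  obtain ⟨s, hs⟩ := hτ
  have hint (m u : Fin n → ℤ) : pairing m (fun i => (u i : ℝ)) = ((∑ i, m i * u i : ℤ) : ℝ) := by
    simp [pairing]
  refine ⟨∑ u ∈ s, (∑ i, w i * u i).natAbs, fun v hv => ?_⟩
  rw [hs] at hv
  induction hv using Submodule.span_induction with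
  | mem x hx =>
    obtain ⟨u, hu, rfl⟩ := hx
    have huτ : (fun i => (u i : ℝ)) ∈ τ := by
      rw [hs]
      exact Submodule.subset_span ⟨u, hu, rfl⟩
    have h0 := hm _ huτ
    rw [pairing_add, pairing_nsmul]
    rcases h0.eq_or_lt with h | h
    · have := hw _ ((hσ _).2 ⟨huτ, h.symm⟩)
      rw [← h, mul_zero, add_zero]
      exact this
    · rw [hint] at h ⊢
      rw [hint]
      have h1 : 1 ≤ ∑ i, m i * u i := by exact_mod_cast h
      have h2 : (∑ i, w i * u i).natAbs ≤ ∑ u ∈ s, (∑ i, w i * u i).natAbs :=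
        Finset.single_le_sum (f := fun u => (∑ i, w i * u i).natAbs) (fun _ _ => Nat.zero_le _) hu
      have h3 : 0 ≤ (∑ i, w i * u i) +
          ((∑ u ∈ s, (∑ i, w i * u i).natAbs : ℕ) : ℤ) * (∑ i, m i * u i) := by
        have h4 : -(∑ i, w i * u i) ≤ ((∑ u ∈ s, (∑ i, w i * u i).natAbs : ℕ) : ℤ) := by
          have : (((∑ i, w i * u i).natAbs : ℕ) : ℤ) ≤
            ((∑ u ∈ s, (∑ i, w i * u i).natAbs : ℕ) : ℤ) := by exact_mod_cast h2
          omega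
        nlinarith
      have h5 := (Int.cast_le (R := ℝ)).2 h3
      rw [Int.cast_zero, Int.cast_add, Int.cast_mul, Int.cast_natCast] at h5
      exact h5
  | zero => simp [pairing]
  | add x y _ _ hx hy =>
    rw [pairing_add_right]
    exact add_nonneg hx hy
  | smul a x _ hx =>
    have : a • x = (a : ℝ) • x := rfl
    rw [this, pairing_smul_right]
    exact mul_nonneg a.2 hx

lemma algHom_ext_single {M : Type*} [AddMonoid M] {B : Type*} [Semiring B] [Algebra k B]
    {f g : AddMonoidAlgebra k M →ₐ[k] B}
    (h : ∀ m, f (AddMonoidAlgebra.single m 1) = g (AddMonoidAlgebra.single m 1)) : f = g :=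
  AddMonoidAlgebra.algHom_ext h (by ext)

lemma coordRingMap_single {σ τ : PointedCone ℝ (Fin n → ℝ)} (h : σ ≤ τ) (m : dualMonoid τ)
    (a : k) : coordRingMap k h (AddMonoidAlgebra.single m a) =
      AddMonoidAlgebra.single (AddSubmonoid.inclusion (dualMonoid_anti h) m) a := by
  simp [coordRingMap, AddMonoidAlgebra.mapDomainAlgHom_apply]

lemma coordRingMap_injective {σ τ : PointedCone ℝ (Fin n → ℝ)} (h : σ ≤ τ) :
    Function.Injective (coordRingMap k h) :=
  AddMonoidAlgebra.mapDomain_injective (AddSubmonoid.inclusion_injective _)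

lemma coordRingMap_isLocalization {σ τ : PointedCone ℝ (Fin n → ℝ)} (h : σ ≤ τ)
    (hτ : IsRationalPolyhedral τ) (m : dualMonoid τ)
    (hσ : ∀ v, v ∈ σ ↔ v ∈ τ ∧ pairing m.1 v = 0) :
    letI := (coordRingMap k h).toRingHom.toAlgebra
    IsLocalization.Away (AddMonoidAlgebra.single m (1 : k)) (CoordRing k σ) := by
  let _ := (coordRingMap k h).toRingHom.toAlgebra
  have hmap : ∀ x, algebraMap (CoordRing k τ) (CoordRing k σ) x = coordRingMap k h x :=
    fun _ => rfl
  have hneg : -m.1 ∈ dualMonoid σ := fun v hv => by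
    have h1 : pairing (-m.1 + m.1) v = 0 := by rw [neg_add_cancel, pairing_zero]
    rw [pairing_add, ((hσ v).1 hv).2, add_zero] at h1
    exact h1.ge
  have hpow (N : ℕ) : (AddMonoidAlgebra.single m (1 : k)) ^ N =
      AddMonoidAlgebra.single (N • m) (1 : k) := by
    rw [AddMonoidAlgebra.single_pow, one_pow]
  rw [IsLocalization.Away, isLocalization_iff]
  refine ⟨?_, ?_, ?_⟩
  · rintro ⟨_, N, rfl⟩
    simp only [map_pow]
    refine IsUnit.pow _ ?_
    rw [hmap, coordRingMap_single]
    refine IsUnit.of_mul_eq_one (AddMonoidAlgebra.single (⟨-m.1, hneg⟩ : dualMonoid σ) (1 : k)) ?_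
    rw [AddMonoidAlgebra.single_mul_single, AddMonoidAlgebra.one_def, mul_one]
    congr 1
    exact Subtype.ext (add_neg_cancel m.1)
  · suffices H : ∀ z : CoordRing k σ, ∃ (N : ℕ) (x : CoordRing k τ),
        z * coordRingMap k h (AddMonoidAlgebra.single m (1 : k)) ^ N = coordRingMap k h x by
      intro z
      obtain ⟨N, x, hx⟩ := H z
      refine ⟨(x, ⟨_, N, rfl⟩), ?_⟩
      simp only [hmap, map_pow]
      exact hx
    intro z
    induction z using AddMonoidAlgebra.induction_linear with
    | zero => exact ⟨0, 0, by simp⟩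
    | add f g hf hg =>
      obtain ⟨N, x, hx⟩ := hf
      obtain ⟨N', x', hx'⟩ := hg
      refine ⟨N + N', x * AddMonoidAlgebra.single m (1 : k) ^ N' +
        x' * AddMonoidAlgebra.single m (1 : k) ^ N, ?_⟩
      rw [map_add, map_mul, map_mul, ← hx, ← hx', map_pow, map_pow]
      ring
    | single w a =>
      obtain ⟨N, hN⟩ := exists_nsmul_add_mem hτ m.2 hσ w.2
      refine ⟨N, AddMonoidAlgebra.single ⟨_, hN⟩ a, ?_⟩
      rw [← map_pow, hpow, coordRingMap_single, coordRingMap_single,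
        AddMonoidAlgebra.single_mul_single, mul_one]
      congr 1
  · intro x y hxy
    exact ⟨1, by rw [coordRingMap_injective k h hxy]⟩

lemma IsFace.le {σ τ : PointedCone ℝ (Fin n → ℝ)} (h : IsFace σ τ) : σ ≤ τ := by
  obtain ⟨m, -, hσ⟩ := h
  exact fun v hv => ((hσ v).1 hv).1

lemma chartMap_isOpenImmersion {σ τ : PointedCone ℝ (Fin n → ℝ)} (h : σ ≤ τ)
    (hτ : IsRationalPolyhedral τ) (hface : IsFace σ τ) : IsOpenImmersion (chartMap k h) := by
  obtain ⟨m, hm, hσ⟩ := hface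
  let _ := (coordRingMap k h).toRingHom.toAlgebra
  have := coordRingMap_isLocalization k h hτ ⟨m, hm⟩ hσ
  exact IsOpenImmersion.of_isLocalization (AddMonoidAlgebra.single (⟨m, hm⟩ : dualMonoid τ) (1 : k))

lemma range_chartMap {σ τ : PointedCone ℝ (Fin n → ℝ)} (h : σ ≤ τ)
    (hτ : IsRationalPolyhedral τ) (m : dualMonoid τ)
    (hσ : ∀ v, v ∈ σ ↔ v ∈ τ ∧ pairing m.1 v = 0) :
    Set.range (chartMap k h) =
      (PrimeSpectrum.basicOpen (AddMonoidAlgebra.single m (1 : k)) :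
        Set (PrimeSpectrum (CoordRing k τ))) := by
  let _ := (coordRingMap k h).toRingHom.toAlgebra
  have := coordRingMap_isLocalization k h hτ m hσ
  exact PrimeSpectrum.localization_away_comap_range (CoordRing k σ) _

/-! ### Gluing -/

variable (F : Fan n)

lemma Fan.isFace_of_le {σ τ : F.cones} (h : σ ≤ τ) : IsFace σ.1 τ.1 := by
  have := F.inter_face τ.1 τ.2 σ.1 σ.2
  rwa [inf_eq_right.2 (show σ.1 ≤ τ.1 from h)] at this

@[simp] lemma coordRingMap_refl (σ : PointedCone ℝ (Fin n → ℝ)) :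
    coordRingMap k (le_refl σ) = AlgHom.id k _ := by
  refine algHom_ext_single k (fun m => ?_)
  rw [coordRingMap_single]
  rfl

lemma coordRingMap_comp {ρ σ τ : PointedCone ℝ (Fin n → ℝ)} (h : ρ ≤ σ) (h' : σ ≤ τ) :
    (coordRingMap k h).comp (coordRingMap k h') = coordRingMap k (h.trans h') := by
  refine algHom_ext_single k (fun m => ?_)
  rw [AlgHom.comp_apply, coordRingMap_single, coordRingMap_single, coordRingMap_single]
  rfl

/-- The diagram of the affine charts `U_σ`, for `σ` in the fan, and their inclusions. -/
def diagram : F.cones ⥤ Scheme.{u} where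
  obj σ := chart k σ.1
  map f := chartMap k (leOfHom f)
  map_id σ := by
    simp only [chartMap]
    rw [coordRingMap_refl]
    exact Spec.map_id _
  map_comp f g := by
    simp only [chartMap]
    rw [← Spec.map_comp, ← CommRingCat.ofHom_comp, ← coordRingMap_comp k (leOfHom f) (leOfHom g)]
    rfl

instance diagram_isOpenImmersion {σ τ : F.cones} (f : σ ⟶ τ) :
    IsOpenImmersion ((diagram k F).map f) :=
  chartMap_isOpenImmersion k (leOfHom f) (F.rational _ τ.2) (F.isFace_of_le (leOfHom f))

instance diagram_isLocallyDirected : (diagram k F ⋙ Scheme.forget).IsLocallyDirected where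
  cond {σ₁ σ₂ τ} f₁ f₂ x₁ x₂ hx := by
    obtain ⟨m₁, hm₁, h₁⟩ := F.isFace_of_le (leOfHom f₁)
    obtain ⟨m₂, hm₂, h₂⟩ := F.isFace_of_le (leOfHom f₂)
    let ρ : F.cones := ⟨σ₁.1 ⊓ σ₂.1,
      F.face_mem _ σ₁.2 _ (F.inter_face _ σ₁.2 _ σ₂.2)⟩
    have hρ₁ : ρ ≤ σ₁ := (inf_le_left : σ₁.1 ⊓ σ₂.1 ≤ σ₁.1)
    have hρ₂ : ρ ≤ σ₂ := (inf_le_right : σ₁.1 ⊓ σ₂.1 ≤ σ₂.1)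
    have hρ : ∀ v, v ∈ ρ.1 ↔ v ∈ τ.1 ∧ pairing (m₁ + m₂) v = 0 := by
      intro v
      change (v ∈ σ₁.1 ∧ v ∈ σ₂.1) ↔ _
      rw [h₁, h₂, pairing_add]
      constructor
      · rintro ⟨⟨hv, e₁⟩, -, e₂⟩
        exact ⟨hv, by rw [e₁, e₂, add_zero]⟩
      · rintro ⟨hv, e⟩
        have := hm₁ v hv
        have := hm₂ v hv
        exact ⟨⟨hv, by linarith⟩, hv, by linarith⟩
    have hmem : chartMap k (leOfHom f₁) x₁ ∈ Set.range (chartMap k (hρ₁.trans (leOfHom f₁))) := by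
      rw [range_chartMap k _ (F.rational _ τ.2) (⟨m₁, hm₁⟩ + ⟨m₂, hm₂⟩) hρ]
      have e₁ : chartMap k (leOfHom f₁) x₁ ∈ Set.range (chartMap k (leOfHom f₁)) := ⟨x₁, rfl⟩
      have e₂ : chartMap k (leOfHom f₁) x₁ ∈ Set.range (chartMap k (leOfHom f₂)) := ⟨x₂, hx.symm⟩
      rw [range_chartMap k _ (F.rational _ τ.2) ⟨m₁, hm₁⟩ h₁] at e₁
      rw [range_chartMap k _ (F.rational _ τ.2) ⟨m₂, hm₂⟩ h₂] at e₂
      rw [← mul_one (1 : k), ← AddMonoidAlgebra.single_mul_single, PrimeSpectrum.basicOpen_mul]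
      exact ⟨e₁, e₂⟩
    obtain ⟨x, hx'⟩ := hmem
    have key (σ : F.cones) (f : σ ⟶ τ) (g : ρ ⟶ σ) (y : (diagram k F).obj σ)
        (hy : (diagram k F).map f y = (diagram k F).map f₁ x₁) :
        (diagram k F).map g x = y := by
      apply ((diagram k F).map f).isOpenEmbedding.injective
      refine Eq.trans ?_ hy.symm
      refine Eq.trans ?_ hx'
      refine (Scheme.Hom.comp_apply ((diagram k F).map g) ((diagram k F).map f) x).symm.trans ?_
      rw [← Functor.map_comp]
      rfl
    exact ⟨ρ, homOfLE hρ₁, homOfLE hρ₂, x, key _ f₁ (homOfLE hρ₁) _ rfl,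
      key _ f₂ (homOfLE hρ₂) _ hx.symm⟩

/-- The toric variety `X_F` of the fan: the gluing of the affine charts `U_σ` along the open
subsets `U_{σ ∩ τ}`. -/
def X : Scheme.{u} := colimit (diagram k F)

/-- The inclusion `U_σ ⟶ X_F` of an affine chart. -/
def ι (σ : F.cones) : chart k σ.1 ⟶ X k F := colimit.ι (diagram k F) σ

instance (σ : F.cones) : IsOpenImmersion (ι k F σ) :=
  inferInstanceAs (IsOpenImmersion (colimit.ι (diagram k F) σ))

lemma chartMap_ι {σ τ : F.cones} (h : σ ≤ τ) : chartMap k h ≫ ι k F τ = ι k F σ :=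
  colimit.w (diagram k F) (homOfLE h)

lemma chartMap_chartToSpec {σ τ : PointedCone ℝ (Fin n → ℝ)} (h : σ ≤ τ) :
    chartMap k h ≫ chartToSpec k τ = chartToSpec k σ := by
  simp only [chartMap, chartToSpec]
  rw [← Spec.map_comp, ← CommRingCat.ofHom_comp]
  congr 2
  exact (coordRingMap k h).comp_algebraMap

/-- The structure morphism `X_F ⟶ Spec k`. -/
def toSpec : X k F ⟶ Spec (CommRingCat.of k) :=
  colimit.desc (diagram k F)
    { pt := Spec (CommRingCat.of k)
      ι :=
        { app := fun σ => chartToSpec k σ.1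
          naturality := fun _ _ f =>
            (chartMap_chartToSpec k (leOfHom f)).trans (Category.comp_id _).symm } }

lemma ι_toSpec (σ : F.cones) : ι k F σ ≫ toSpec k F = chartToSpec k σ.1 :=
  colimit.ι_desc _ _

/-- The open cover of `X_F` by the affine charts `U_σ`. -/
def chartCover : (X k F).OpenCover := Scheme.IsLocallyDirected.openCover (diagram k F)

instance : Category (chartCover k F).I₀ := inferInstanceAs (Category F.cones)

instance : (chartCover k F).LocallyDirected where
  trans f := (diagram k F).map f
  trans_id σ := (diagram k F).map_id σ
  trans_comp f g := (diagram k F).map_comp f g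
  w f := colimit.w (diagram k F) f
  directed {σ τ} x := by
    have h := congr($(pullback.condition (f := (chartCover k F).f σ) (g := (chartCover k F).f τ)) x)
    rw [Scheme.Hom.comp_apply, Scheme.Hom.comp_apply] at h
    obtain ⟨ρ, f, g, y, hf, hg⟩ := (Scheme.IsLocallyDirected.ι_eq_ι_iff (diagram k F)).1 h
    refine ⟨ρ, f, g, y, ?_⟩
    apply (pullback.fst ((chartCover k F).f σ) ((chartCover k F).f τ)).isOpenEmbedding.injective
    refine Eq.trans ?_ hf
    refine (Scheme.Hom.comp_apply (pullback.lift ((diagram k F).map f) ((diagram k F).map g) _)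
      (pullback.fst ((chartCover k F).f σ) ((chartCover k F).f τ)) y).symm.trans ?_
    exact congrArg (fun φ : (diagram k F).obj ρ ⟶ (chartCover k F).X σ => φ y)
      (pullback.lift_fst _ _ _)
  property_trans f := diagram_isOpenImmersion k F f

/-! ### The torus action -/

/-- The torus `T = Spec k[M]`, where `M = ℤⁿ`. -/
abbrev torus (n : ℕ) : Scheme.{u} := Spec (CommRingCat.of (AddMonoidAlgebra k (Fin n → ℤ)))

/-- The structure morphism `T ⟶ Spec k`. -/
abbrev torusToSpec (n : ℕ) : torus k n ⟶ Spec (CommRingCat.of k) :=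
  Spec.map (CommRingCat.ofHom (algebraMap k (AddMonoidAlgebra k (Fin n → ℤ))))

/-- The coaction `k[σ^∨ ∩ M] → k[M] ⊗ k[σ^∨ ∩ M]`, `χ^m ↦ χ^m ⊗ χ^m`. -/
def coaction (σ : PointedCone ℝ (Fin n → ℝ)) :
    CoordRing k σ →ₐ[k] AddMonoidAlgebra k (Fin n → ℤ) ⊗[k] CoordRing k σ :=
  AddMonoidAlgebra.lift k _ _
    { toFun := fun m => AddMonoidAlgebra.single m.toAdd.1 1 ⊗ₜ AddMonoidAlgebra.single m.toAdd 1
      map_one' := rfl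
      map_mul' := fun a b => by
        simp [Algebra.TensorProduct.tmul_mul_tmul, AddMonoidAlgebra.single_mul_single] }

lemma coaction_single (σ : PointedCone ℝ (Fin n → ℝ)) (m : dualMonoid σ) :
    coaction k σ (AddMonoidAlgebra.single m 1) =
      AddMonoidAlgebra.single m.1 1 ⊗ₜ AddMonoidAlgebra.single m 1 := by
  simp [coaction]

/-- The action `T ×ₖ U_σ ⟶ U_σ` of the torus on an affine chart. -/
def chartAction (σ : PointedCone ℝ (Fin n → ℝ)) :
    pullback (torusToSpec k n) (chartToSpec k σ) ⟶ chart k σ :=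
  (pullbackSpecIso k (AddMonoidAlgebra k (Fin n → ℤ)) (CoordRing k σ)).hom ≫
    Spec.map (CommRingCat.ofHom (coaction k σ).toRingHom)

lemma chartAction_naturality {σ τ : PointedCone ℝ (Fin n → ℝ)} (h : σ ≤ τ) :
    pullback.map (torusToSpec k n) (chartToSpec k σ) (torusToSpec k n) (chartToSpec k τ)
      (𝟙 _) (chartMap k h) (𝟙 _) (by simp) (by simp [chartMap_chartToSpec]) ≫ chartAction k τ =
      chartAction k σ ≫ chartMap k h := by
  have key : pullback.map (torusToSpec k n) (chartToSpec k σ) (torusToSpec k n) (chartToSpec k τ)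
      (𝟙 _) (chartMap k h) (𝟙 _) (by simp) (by simp [chartMap_chartToSpec]) ≫
      (pullbackSpecIso k (AddMonoidAlgebra k (Fin n → ℤ)) (CoordRing k τ)).hom =
      (pullbackSpecIso k (AddMonoidAlgebra k (Fin n → ℤ)) (CoordRing k σ)).hom ≫
        Spec.map (CommRingCat.ofHom
          (Algebra.TensorProduct.map (AlgHom.id k _) (coordRingMap k h)).toRingHom) := by
    rw [← Iso.eq_comp_inv]
    apply pullback.hom_ext
    · rw [pullback.lift_fst, Category.assoc, Category.assoc, pullbackSpecIso_inv_fst,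
        ← Spec.map_comp, ← CommRingCat.ofHom_comp, Category.comp_id]
      refine (pullbackSpecIso_hom_fst _ _ _).symm.trans ?_
      congr 3
      refine RingHom.ext fun x => ?_
      simp
    · rw [pullback.lift_snd, Category.assoc, Category.assoc, pullbackSpecIso_inv_snd,
        ← Spec.map_comp, ← CommRingCat.ofHom_comp, chartMap]
      refine (congrArg (· ≫ _) (pullbackSpecIso_hom_snd _ _ _).symm).trans ?_
      rw [Category.assoc, ← Spec.map_comp, ← CommRingCat.ofHom_comp]
      congr 3
  unfold chartAction
  rw [reassoc_of% key, Category.assoc, chartMap, ← Spec.map_comp, ← Spec.map_comp,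
    ← CommRingCat.ofHom_comp, ← CommRingCat.ofHom_comp]
  congr 3
  have : ((Algebra.TensorProduct.map (AlgHom.id k _) (coordRingMap k h)).comp (coaction k τ)) =
      (coaction k σ).comp (coordRingMap k h) := by
    refine algHom_ext_single k (fun m => ?_)
    rw [AlgHom.comp_apply, AlgHom.comp_apply, coordRingMap_single, coaction_single,
      coaction_single, Algebra.TensorProduct.map_tmul, coordRingMap_single]
    rfl
  exact congrArg AlgHom.toRingHom this

/-- The morphism `(T ×ₖ X_F) ×_{X_F} U_σ ⟶ U_σ` given by the action on the chart `U_σ`. -/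
def restrictedAction (σ : F.cones) :
    pullback (pullback.snd (torusToSpec k n) (toSpec k F)) (ι k F σ) ⟶ chart k σ.1 :=
  pullback.lift (pullback.fst _ _ ≫ pullback.fst _ _) (pullback.snd _ (ι k F σ))
    (by rw [Category.assoc, pullback.condition, pullback.condition_assoc, ι_toSpec]) ≫
    chartAction k σ.1

lemma restrictedAction_naturality {σ τ : F.cones} (h : σ ≤ τ) :
    pullback.map (pullback.snd (torusToSpec k n) (toSpec k F)) (ι k F σ)
      (pullback.snd (torusToSpec k n) (toSpec k F)) (ι k F τ) (𝟙 _) (chartMap k h) (𝟙 _)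
      (by simp) (by simp [chartMap_ι]) ≫ restrictedAction k F τ ≫ ι k F τ =
      restrictedAction k F σ ≫ ι k F σ := by
  suffices H : pullback.map (pullback.snd (torusToSpec k n) (toSpec k F)) (ι k F σ)
      (pullback.snd (torusToSpec k n) (toSpec k F)) (ι k F τ) (𝟙 _) (chartMap k h) (𝟙 _)
      (by simp) (by simp [chartMap_ι]) ≫ restrictedAction k F τ =
      restrictedAction k F σ ≫ chartMap k h by
    rw [← Category.assoc, H, Category.assoc, chartMap_ι]
  unfold restrictedAction
  rw [Category.assoc, ← chartAction_naturality k (n := n) (show σ.1 ≤ τ.1 from h),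
    ← Category.assoc, ← Category.assoc]
  congr 1
  apply pullback.hom_ext
  · rw [Category.assoc, Category.assoc, pullback.lift_fst, pullback.lift_fst_assoc,
      pullback.lift_fst, pullback.lift_fst_assoc, Category.comp_id, Category.comp_id]
  · rw [Category.assoc, Category.assoc, pullback.lift_snd, pullback.lift_snd,
      pullback.lift_snd, pullback.lift_snd_assoc]

/-- The action `T ×ₖ X_F ⟶ X_F` of the torus on the toric variety, glued from the actions on
the affine charts. -/
def action : pullback (torusToSpec k n) (toSpec k F) ⟶ X k F :=
  Scheme.OpenCover.glueMorphismsOfLocallyDirected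
    ((chartCover k F).pullback₁ (pullback.snd (torusToSpec k n) (toSpec k F)))
    (fun σ : F.cones => restrictedAction k F σ ≫ ι k F σ)
    (fun {σ τ} f => restrictedAction_naturality k F (σ := σ) (τ := τ) (leOfHom f))

/-- On the affine charts, `action` is the action given by `χ^m ↦ χ^m ⊗ χ^m`. -/
lemma chart_action (σ : F.cones) :
    pullback.map (torusToSpec k n) (chartToSpec k σ.1) (torusToSpec k n) (toSpec k F)
      (𝟙 _) (ι k F σ) (𝟙 _) (by simp) (by simp [ι_toSpec]) ≫ action k F =
      chartAction k σ.1 ≫ ι k F σ := by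
  have h := Scheme.OpenCover.map_glueMorphismsOfLocallyDirected
    ((chartCover k F).pullback₁ (pullback.snd (torusToSpec k n) (toSpec k F)))
    (fun σ : F.cones => restrictedAction k F σ ≫ ι k F σ)
    (fun {σ τ} f => restrictedAction_naturality k F (σ := σ) (τ := τ) (leOfHom f)) σ
  have h' : pullback.fst (pullback.snd (torusToSpec k n) (toSpec k F)) (ι k F σ) ≫ action k F =
    restrictedAction k F σ ≫ ι k F σ := h
  have e : pullback.map (torusToSpec k n) (chartToSpec k σ.1) (torusToSpec k n) (toSpec k F)
      (𝟙 _) (ι k F σ) (𝟙 _) (by simp) (by simp [ι_toSpec]) =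
      pullback.lift (pullback.map (torusToSpec k n) (chartToSpec k σ.1) (torusToSpec k n)
        (toSpec k F) (𝟙 _) (ι k F σ) (𝟙 _) (by simp) (by simp [ι_toSpec])) (pullback.snd _ _)
        (pullback.lift_snd _ _ _) ≫ pullback.fst (pullback.snd (torusToSpec k n) (toSpec k F)) (ι k F σ) := by
    rw [pullback.lift_fst]
  rw [e, Category.assoc, h', restrictedAction, ← Category.assoc, ← Category.assoc]
  congr 1
  conv_rhs => rw [← Category.id_comp (chartAction k σ.1)]
  congr 1
  apply pullback.hom_ext
  · rw [Category.assoc, pullback.lift_fst, pullback.lift_fst_assoc, pullback.lift_fst,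
      Category.comp_id, Category.id_comp]
  · rw [Category.assoc, pullback.lift_snd, pullback.lift_snd, Category.id_comp]

/-- An ideal sheaf on the toric variety is toric if it is invariant under the torus: its inverse
images under the action `T ×ₖ X_F ⟶ X_F` and the projection `T ×ₖ X_F ⟶ X_F` agree. -/
def IsToric (I : (X k F).IdealSheafData) : Prop :=
  I.comap (action k F) = I.comap (pullback.snd (torusToSpec k n) (toSpec k F))

/-! ### The boundary and toroidal ideals -/

/-- The boundary `Δ = X_F ∖ T`: the complement of the open torus `U_{0} ⊆ X_F`. -/
def boundary : Set (X k F) := (Set.range (ι k F ⟨⊥, F.bot_mem⟩))ᶜ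

/-- The index set of the boundary divisors: the irreducible components of `Δ`. -/
def BoundaryDivisor : Type u :=
  {D : Closeds (X k F) // Maximal (fun Z : Closeds (X k F) =>
    IsIrreducible (Z : Set (X k F)) ∧ (Z : Set (X k F)) ⊆ boundary k F) D}

end Toric

/-- Let `D i` be divisors on `Y`. An ideal sheaf `I` on `Y` is toroidal with respect to `∑ D i`
if `Y` is covered by (affine) open sets `U` on which `I` is a sum, over a (possibly empty) family
of exponents `m`, of the ideals `𝒪_U(-∑ m i • D i) = ∏ 𝒪_U(-D i) ^ m i`, where `𝒪_Y(-D i)` is the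
ideal sheaf of the reduced closed subscheme `D i`. -/
def IsToroidal {Y : Scheme.{u}} {ι : Type u} (D : ι → Closeds Y) (I : Y.IdealSheafData) : Prop :=
  ∀ y : Y, ∃ U : Y.affineOpens, y ∈ U.1 ∧ ∃ S : Set (ι →₀ ℕ),
    I.ideal U = ⨆ m ∈ S, m.prod fun i e => (Scheme.IdealSheafData.vanishingIdeal (D i)).ideal U ^ e

end

/-! Both conditions are equivalent to a third one: on every chart `U_σ` the ideal of `I` is
generated by monomials `χ^m`.

Toric means monomial (`isToric_iff`). The coaction multiplies `χ^m` by the unit `χ^m ⊗ 1`, so it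
preserves monomial ideals; conversely, invariance allows the `χ^m`-component of an element of the
ideal to be extracted inside the ideal (`map_coaction_eq_iff`).

Monomial implies toroidal. Here smoothness enters: it makes every ideal `(χ^m)` on a chart the
restriction of some `𝒪(-∑ eᵢ Dᵢ)` (`exists_divisorIdeal`). Since `m` is a sum of irreducible
elements and a unit, it suffices that an irreducible `h` generates a prime ideal, whose zero locus
is then the trace of a component of the boundary (`exists_boundaryDivisor`). Primality is obtained
without classifying smooth cones. Formal smoothness lifts a suitable 1-jet to a homomorphism from
the coordinate ring to `k[x]⟦t⟧`; the images of monomials have leading terms `xⁱtᵈ`, and `i ≠ 0`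
forces `h` to divide the monomial (`exists_eq_add_of_addIrreducible`). Additivity of `i` gives
primality.

Toroidal implies monomial. The boundary divisors have monomial ideals (`isMonomial_vanishingIdeal`),
hence so do all the local models `∑ 𝒪(-∑ eᵢ Dᵢ)`. A monomial ideal on a chart is determined by its
germ at the generic point of the closed orbit (`IsMonomial.le_of_forall_exists`). Comparing models
at the generic points of the orbits, the model valid at the closed orbit of `U_σ` is valid on all of
`U_σ` (`isMonomial_of_isToroidal`). -/

noncomputable section

namespace Toric

/-! ### Monomial ideals in monoid algebras. -/

section MonoidAlgebra

open AddMonoidAlgebra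

variable {k : Type*} [Field k] {P : Type*} [AddCommMonoid P]

/-- An ideal of a monoid algebra is monomial if it contains the monomials of its elements. -/
def IsMonomial (J : Ideal (AddMonoidAlgebra k P)) : Prop :=
  ∀ f ∈ J, ∀ m ∈ f.coeff.support, single m 1 ∈ J

/-- The ideal generated by the monomials `χ^m`, `m ∈ s`. -/
def monomialIdeal (k : Type*) [Field k] {P : Type*} [AddCommMonoid P] (s : Set P) :
    Ideal (AddMonoidAlgebra k P) :=
  Ideal.span ((fun m => single m (1 : k)) '' s)

lemma mem_monomialIdeal {s : Set P} {f : AddMonoidAlgebra k P} :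
    f ∈ monomialIdeal k s ↔ ∀ m ∈ f.coeff.support, ∃ m' ∈ s, ∃ d, m = d + m' :=
  mem_ideal_span_of'_image

lemma single_mem_monomialIdeal {s : Set P} {m : P} :
    single m (1 : k) ∈ monomialIdeal k s ↔ ∃ m' ∈ s, ∃ d, m = d + m' := by
  rw [mem_monomialIdeal]
  simp

lemma isMonomial_monomialIdeal (s : Set P) : IsMonomial (monomialIdeal k s) := fun _ hf m hm =>
  single_mem_monomialIdeal.2 (mem_monomialIdeal.1 hf m hm)

lemma monomialIdeal_le {s : Set P} {J : Ideal (AddMonoidAlgebra k P)} :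
    monomialIdeal k s ≤ J ↔ ∀ m ∈ s, single m (1 : k) ∈ J := by
  simp [monomialIdeal, Ideal.span_le, Set.subset_def]

lemma eq_sum_single (f : AddMonoidAlgebra k P) :
    f = ∑ m ∈ f.coeff.support, single 0 (f.coeff m) * single m 1 := by
  conv_lhs => rw [← sum_coeff_single f, Finsupp.sum]
  simp [single_mul_single]

lemma mem_of_forall_single_mem {J : Ideal (AddMonoidAlgebra k P)} {f : AddMonoidAlgebra k P}
    (h : ∀ m ∈ f.coeff.support, single m 1 ∈ J) : f ∈ J := by
  rw [eq_sum_single f]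
  exact sum_mem fun m hm => J.mul_mem_left _ (h m hm)

lemma IsMonomial.eq {J : Ideal (AddMonoidAlgebra k P)} (hJ : IsMonomial J) :
    J = monomialIdeal k {m | single m 1 ∈ J} := by
  refine le_antisymm (fun f hf => mem_of_forall_single_mem fun m hm => ?_)
    (monomialIdeal_le.2 fun _ hm => hm)
  exact single_mem_monomialIdeal.2 ⟨m, hJ f hf m hm, 0, (zero_add m).symm⟩

lemma IsMonomial.top : IsMonomial (⊤ : Ideal (AddMonoidAlgebra k P)) := fun _ _ _ _ => trivial

lemma IsMonomial.mul {J J' : Ideal (AddMonoidAlgebra k P)} (h : IsMonomial J)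
    (h' : IsMonomial J') : IsMonomial (J * J') := by
  have : J * J' = monomialIdeal k {m | ∃ a b, single a 1 ∈ J ∧ single b 1 ∈ J' ∧ a + b = m} := by
    conv_lhs => rw [h.eq, h'.eq, monomialIdeal, monomialIdeal, Ideal.span_mul_span']
    rw [monomialIdeal]
    congr 1
    ext f
    simp only [Set.mem_mul, Set.mem_image]
    constructor
    · rintro ⟨_, ⟨a, ha, rfl⟩, _, ⟨b, hb, rfl⟩, rfl⟩
      exact ⟨a + b, ⟨a, b, ha, hb, rfl⟩, by simp [single_mul_single]⟩
    · rintro ⟨_, ⟨a, b, ha, hb, rfl⟩, rfl⟩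
      exact ⟨_, ⟨a, ha, rfl⟩, _, ⟨b, hb, rfl⟩, by simp [single_mul_single]⟩
  rw [this]
  exact isMonomial_monomialIdeal _

lemma IsMonomial.pow {J : Ideal (AddMonoidAlgebra k P)} (h : IsMonomial J) (e : ℕ) :
    IsMonomial (J ^ e) := by
  induction e with
  | zero => simpa using IsMonomial.top
  | succ e ih => rw [pow_succ]; exact ih.mul h

lemma IsMonomial.iSup {ι : Sort*} {J : ι → Ideal (AddMonoidAlgebra k P)}
    (h : ∀ i, IsMonomial (J i)) : IsMonomial (⨆ i, J i) := by
  have : ⨆ i, J i = monomialIdeal k (⋃ i, {m | single m 1 ∈ J i}) := by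
    refine le_antisymm (iSup_le fun i => ?_) (monomialIdeal_le.2 fun m hm => ?_)
    · rw [(h i).eq]
      refine monomialIdeal_le.2 fun m hm => ?_
      exact single_mem_monomialIdeal.2 ⟨m, Set.mem_iUnion.2 ⟨i, hm⟩, 0, (zero_add m).symm⟩
    · obtain ⟨i, hi⟩ := Set.mem_iUnion.1 hm
      exact Ideal.mem_iSup_of_mem i hi
  rw [this]
  exact isMonomial_monomialIdeal _

lemma monomialIdeal_singleton_add (a b : P) :
    monomialIdeal k {a + b} = monomialIdeal k {a} * monomialIdeal k {b} := by
  simp [monomialIdeal, Ideal.span_singleton_mul_span_singleton, single_mul_single]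

lemma isUnit_single {m : P} (hm : IsAddUnit m) : IsUnit (single m (1 : k)) := by
  obtain ⟨m', hm'⟩ := hm.exists_neg
  refine IsUnit.of_mul_eq_one (single m' 1) ?_
  rw [single_mul_single, hm', mul_one, AddMonoidAlgebra.one_def]

lemma monomialIdeal_singleton_of_isAddUnit {m : P} (hm : IsAddUnit m) :
    monomialIdeal k {m} = ⊤ := by
  rw [monomialIdeal, Set.image_singleton]
  exact Ideal.span_singleton_eq_top.2 (isUnit_single hm)

/-- The complement of `s` is a face of `P`, so killing the monomials in `s` and keeping the others
is a ring endomorphism of the monoid algebra. Its kernel is the ideal in question, and its target is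
a domain. -/
lemma monomialIdeal_isPrime [IsDomain (AddMonoidAlgebra k P)] {s : Set P} (h0 : 0 ∉ s)
    (hadd : ∀ m ∈ s, ∀ d, d + m ∈ s) (hs : ∀ a b, a + b ∈ s → a ∈ s ∨ b ∈ s) :
    (monomialIdeal k s).IsPrime := by
  classical
  let g : Multiplicative P →* AddMonoidAlgebra k P :=
    { toFun := fun m => if m.toAdd ∈ s then 0 else single m.toAdd 1
      map_one' := by simp [h0, AddMonoidAlgebra.one_def]
      map_mul' := fun a b => by
        rw [toAdd_mul]
        by_cases ha : a.toAdd ∈ s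
        · rw [if_pos (by rw [add_comm]; exact hadd _ ha _), if_pos ha, zero_mul]
        by_cases hb : b.toAdd ∈ s
        · rw [if_pos (hadd _ hb _), if_pos hb, mul_zero]
        rw [if_neg ha, if_neg hb, if_neg (fun h => (hs _ _ h).elim ha hb), single_mul_single,
          mul_one] }
  let φ := AddMonoidAlgebra.lift k (AddMonoidAlgebra k P) P g
  have hφ : ∀ (f : AddMonoidAlgebra k P) (m : P),
      (φ f).coeff m = if m ∈ s then 0 else f.coeff m := by
    intro f m
    induction f using AddMonoidAlgebra.induction_linear with
    | zero => simp
    | add f g hf hg =>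
      rw [map_add, coeff_add, coeff_add, Finsupp.add_apply, Finsupp.add_apply, hf, hg]
      split_ifs <;> simp
    | single a r =>
      have : φ (single a r) = r • (if a ∈ s then 0 else single a 1) := by
        simp [φ, g, lift_single]
      rw [this]
      by_cases ha : a ∈ s <;> by_cases hm : m ∈ s
      · simp [ha, hm]
      · have : a ≠ m := fun h => hm (h ▸ ha)
        simp [ha, hm, this]
      · have : a ≠ m := fun h => ha (h ▸ hm)
        simp [ha, hm, this]
      · simp [ha, hm]
  have hker : monomialIdeal k s = RingHom.ker φ := by
    ext f
    rw [RingHom.mem_ker, mem_monomialIdeal]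
    constructor
    · intro h
      ext m
      rw [hφ]
      split_ifs with hm
      · simp
      · by_contra hne
        obtain ⟨m', hm', d, rfl⟩ := h m (Finsupp.mem_support_iff.2 hne)
        exact hm (hadd _ hm' _)
    · intro h m hm
      refine ⟨m, ?_, 0, (zero_add m).symm⟩
      by_contra hms
      have := hφ f m
      rw [h, if_neg hms] at this
      exact Finsupp.mem_support_iff.1 hm this.symm
  rw [hker]
  exact RingHom.ker_isPrime φ

/-- The monomials contained in a prime ideal generate a prime ideal. -/
lemma monomialPart_isPrime [IsDomain (AddMonoidAlgebra k P)] (q : Ideal (AddMonoidAlgebra k P))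
    [hq : q.IsPrime] : (monomialIdeal k {m | single m 1 ∈ q}).IsPrime := by
  refine monomialIdeal_isPrime ?_ ?_ ?_
  · intro h
    exact hq.ne_top ((Ideal.eq_top_iff_one q).2 h)
  · intro m hm d
    have := q.mul_mem_left (single d 1) hm
    rwa [single_mul_single, mul_one] at this
  · intro a b h
    have h : single (a + b) 1 ∈ q := h
    rw [← mul_one (1 : k), ← single_mul_single] at h
    exact hq.mem_or_mem h

lemma exists_single_notMem {q : Ideal (AddMonoidAlgebra k P)} {f : AddMonoidAlgebra k P}
    (hf : f ∉ q) : ∃ m ∈ f.coeff.support, single m 1 ∉ q := by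
  by_contra! h
  exact hf (mem_of_forall_single_mem h)

variable (k P) in
/-- The ideal generated by the monomials that are not invertible. -/
def nonunitIdeal : Ideal (AddMonoidAlgebra k P) := monomialIdeal k {m | ¬ IsAddUnit m}

lemma mem_nonunitIdeal {f : AddMonoidAlgebra k P} :
    f ∈ nonunitIdeal k P ↔ ∀ m ∈ f.coeff.support, ¬ IsAddUnit m := by
  rw [nonunitIdeal, mem_monomialIdeal]
  refine forall₂_congr fun m hm => ⟨?_, fun h => ⟨m, h, 0, (zero_add m).symm⟩⟩
  rintro ⟨m', hm', d, rfl⟩ h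
  exact hm' (isAddUnit_of_add_isAddUnit_right h)

instance nonunitIdeal_isPrime [IsDomain (AddMonoidAlgebra k P)] : (nonunitIdeal k P).IsPrime := by
  refine monomialIdeal_isPrime (fun h => h isAddUnit_zero) (fun m hm d h => ?_) (fun a b h => ?_)
  · exact hm (isAddUnit_of_add_isAddUnit_right h)
  · by_contra! h'
    simp only [Set.mem_ofPred_eq, not_not] at h' h
    exact h (h'.1.add h'.2)

/-- Two monomial ideals agree if they agree locally at a prime ideal containing all
noninvertible monomials. -/
lemma IsMonomial.le_of_forall_exists [IsCancelAdd P] {J J' : Ideal (AddMonoidAlgebra k P)}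
    (hJ : IsMonomial J) (hJ' : IsMonomial J') {q : Ideal (AddMonoidAlgebra k P)}
    (hq : nonunitIdeal k P ≤ q) (h : ∀ f ∈ J, ∃ s ∉ q, s * f ∈ J') : J ≤ J' := by
  rw [hJ.eq, monomialIdeal_le]
  intro m hm
  obtain ⟨s, hs, hsm⟩ := h _ hm
  obtain ⟨u, hu, huq⟩ := exists_single_notMem hs
  -- All noninvertible monomials lie in `q`, so a monomial outside `q` is invertible.
  have huu : IsAddUnit u := by
    by_contra hu'
    exact huq (hq (monomialIdeal_le.1 le_rfl u hu'))
  -- By cancellation nothing else in `s * χ^m` contributes to degree `u + m`, so the coefficient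
  -- there is that of `χ^u` in `s`.
  have hmem := hJ' _ hsm (u + m) (by
    rw [Finsupp.mem_support_iff, coeff_mul_single_eq_coeff_mul (m₂ := u)]
    · simpa using hu
    · intro a _
      exact add_left_inj m)
  rw [← mul_one (1 : k), ← single_mul_single] at hmem
  exact (Ideal.unit_mul_mem_iff_mem J' (isUnit_single huu)).1 hmem

end MonoidAlgebra

/-! ### Formal smoothness makes irreducible monoid elements prime. -/

section Smooth

open AddMonoidAlgebra

/-- `I` and `I ^ n` define the same topology. The case `I = (t)`, `n = 2` allows lifting from
`S/(t²)` directly. -/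
lemma isAdicComplete_pow {S : Type*} [CommRing S] (I : Ideal S) [IsAdicComplete I S] {n : ℕ}
    (hn : 0 < n) : IsAdicComplete (I ^ n) S := by
  let _ : TopologicalSpace S := I.adicTopology
  let _ : IsTopologicalRing S :=
    I.adic_basis.toRing_subgroups_basis.toRingFilterBasis.isTopologicalRing
  let _ : UniformSpace S := IsTopologicalAddGroup.rightUniformSpace S
  have : IsUniformAddGroup S := isUniformAddGroup_of_addCommGroup
  have h : IsAdic I := rfl
  have h2 := is_ideal_adic_pow h hn
  exact h2.isAdicComplete_iff.2 (h.isAdicComplete_iff.1 inferInstance)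

variable {k : Type*} [Field k] {P : Type*} [AddCommMonoid P]

variable (k) in
open Classical in
/-- The `1`-jet of a monomial: invertible elements go to `1`, irreducible elements divisible by `h`
to `xt`, other irreducible elements to `t`, and all other elements to `0`. -/
def jetFun (h m : P) : PowerSeries (Polynomial k) :=
  if IsAddUnit m then 1 else if AddIrreducible m then
    (if ∃ d, m = h + d then PowerSeries.C Polynomial.X else 1) * PowerSeries.X else 0

lemma jetFun_of_isAddUnit {h m : P} (hm : IsAddUnit m) : jetFun k h m = 1 := if_pos hm

lemma jetFun_add_of_isAddUnit {h u : P} (hu : IsAddUnit u) (m : P) :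
    jetFun k h (u + m) = jetFun k h m := by
  classical
  have h1 : IsAddUnit (u + m) ↔ IsAddUnit m := by simp [hu]
  have h2 : AddIrreducible (u + m) ↔ AddIrreducible m := addIrreducible_isAddUnit_add hu
  have h3 : (∃ d, u + m = h + d) ↔ ∃ d, m = h + d := by
    obtain ⟨v, hv⟩ := hu.exists_neg
    constructor
    · rintro ⟨d, hd⟩
      refine ⟨v + d, ?_⟩
      rw [add_left_comm, ← hd, ← add_assoc, add_comm v, hv, zero_add]
    · rintro ⟨d, rfl⟩
      exact ⟨u + d, add_left_comm _ _ _⟩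
  exact if_congr h1 rfl (if_congr h2 (congrArg (· * _) (if_congr h3 rfl rfl)) rfl)

lemma X_dvd_jetFun {h m : P} (hm : ¬ IsAddUnit m) : PowerSeries.X ∣ jetFun k h m := by
  rw [jetFun, if_neg hm]
  split_ifs
  · exact Dvd.intro_left _ rfl
  · exact Dvd.intro_left _ rfl
  · exact dvd_zero _

variable (k) in
/-- The homomorphism from a commutative monoid to the `1`-jets of `k[x]⟦t⟧` given by `jetFun`. -/
def jet (h : P) : Multiplicative P →* PowerSeries (Polynomial k) ⧸
    (Ideal.span {PowerSeries.X} : Ideal (PowerSeries (Polynomial k))) ^ 2 where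
  toFun m := Ideal.Quotient.mk _ (jetFun k h m.toAdd)
  map_one' := by simp [jetFun]
  map_mul' a b := by
    rw [toAdd_mul]
    by_cases ha : IsAddUnit a.toAdd
    · rw [jetFun_add_of_isAddUnit ha, jetFun_of_isAddUnit ha, map_one, one_mul]
    by_cases hb : IsAddUnit b.toAdd
    · rw [add_comm, jetFun_add_of_isAddUnit hb, jetFun_of_isAddUnit hb, map_one, mul_one]
    -- A sum of two nonunits is neither a unit nor irreducible; on the other side, the product of
    -- their jets is divisible by `t²`.
    have h0 : jetFun k h (a.toAdd + b.toAdd) = 0 := by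
      rw [jetFun, if_neg (by simp [ha]), if_neg]
      intro hab
      exact (hab.isAddUnit_or_isAddUnit rfl).elim ha hb
    rw [h0, map_zero, ← map_mul, eq_comm, Ideal.Quotient.eq_zero_iff_mem,
      Ideal.span_singleton_pow, Ideal.mem_span_singleton, pow_two]
    exact mul_dvd_mul (X_dvd_jetFun ha) (X_dvd_jetFun hb)

lemma exists_algHom_sub_jetFun [Algebra.FormallySmooth k (AddMonoidAlgebra k P)] (h : P) :
    ∃ φ : AddMonoidAlgebra k P →ₐ[k] PowerSeries (Polynomial k),
      ∀ m, PowerSeries.X ^ 2 ∣ φ (single m 1) - jetFun k h m := by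
  have := isAdicComplete_pow (Ideal.span {PowerSeries.X} : Ideal (PowerSeries (Polynomial k)))
    two_pos
  obtain ⟨φ, hφ⟩ := Algebra.FormallySmooth.exists_mkₐ_comp_eq_of_isAdicComplete
    (AddMonoidAlgebra.lift k _ P (jet k h))
  refine ⟨φ, fun m => ?_⟩
  have := DFunLike.congr_fun hφ (single m 1)
  rw [lift_single, one_smul] at this
  rw [← Ideal.mem_span_singleton, ← Ideal.span_singleton_pow, ← Ideal.Quotient.eq]
  exact this

/-- `f` has leading term `xⁱtᵈ`. -/
def HasLeadingTerm (f : PowerSeries (Polynomial k)) (i d : ℕ) : Prop :=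
  PowerSeries.X ^ (d + 1) ∣ f - PowerSeries.C (Polynomial.X ^ i) * PowerSeries.X ^ d

lemma HasLeadingTerm.mul {f g : PowerSeries (Polynomial k)} {i j d e : ℕ}
    (hf : HasLeadingTerm f i d) (hg : HasLeadingTerm g j e) :
    HasLeadingTerm (f * g) (i + j) (d + e) := by
  obtain ⟨a, ha⟩ := hf
  obtain ⟨b, hb⟩ := hg
  rw [sub_eq_iff_eq_add] at ha hb
  refine ⟨PowerSeries.X * a * b + a * PowerSeries.C (Polynomial.X ^ j) +
    PowerSeries.C (Polynomial.X ^ i) * b, ?_⟩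
  rw [ha, hb, pow_add Polynomial.X, map_mul]
  ring

lemma HasLeadingTerm.coeff {f : PowerSeries (Polynomial k)} {i d : ℕ}
    (hf : HasLeadingTerm f i d) {e : ℕ} (he : e ≤ d) :
    PowerSeries.coeff e f = if e = d then Polynomial.X ^ i else 0 := by
  have := PowerSeries.X_pow_dvd_iff.1 hf e (Nat.lt_succ_of_le he)
  rw [map_sub, sub_eq_zero] at this
  rw [this, PowerSeries.coeff_C_mul, PowerSeries.coeff_X_pow]
  simp

/-- `d` is the `t`-adic order of `f`, and `i` is the degree in `x` of its lowest coefficient. -/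
lemma HasLeadingTerm.unique {f : PowerSeries (Polynomial k)} {i j d e : ℕ}
    (hf : HasLeadingTerm f i d) (hf' : HasLeadingTerm f j e) : i = j := by
  have key : ∀ {i j d e : ℕ}, HasLeadingTerm f i d → HasLeadingTerm f j e → ¬ d < e := by
    intro i j d e h h' hlt
    have h1 := h.coeff le_rfl
    rw [h'.coeff hlt.le, if_neg hlt.ne, if_pos rfl] at h1
    exact pow_ne_zero i Polynomial.X_ne_zero h1.symm
  obtain rfl : d = e := by
    have := key hf hf'
    have := key hf' hf
    omega
  have h1 := hf.coeff le_rfl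
  rw [hf'.coeff le_rfl, if_pos rfl, if_pos rfl] at h1
  simpa using (congrArg Polynomial.natDegree h1).symm

/-- Irreducible elements of a graded monoid are prime if the monoid algebra is formally smooth. -/
theorem exists_eq_add_of_addIrreducible [Algebra.FormallySmooth k (AddMonoidAlgebra k P)]
    (ℓ : P →+ ℕ) (hℓ : ∀ m, ℓ m = 0 → IsAddUnit m) {h : P} (hh : AddIrreducible h) {a b c : P}
    (habc : a + b = h + c) : (∃ d, a = h + d) ∨ ∃ d, b = h + d := by
  obtain ⟨φ, hφ⟩ := exists_algHom_sub_jetFun (k := k) h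
  have hirr : ∀ m, AddIrreducible m →
      ∃ i d, HasLeadingTerm (φ (single m 1)) i d ∧ (i ≠ 0 ↔ ∃ d, m = h + d) := by
    intro m hm
    have := hφ m
    rw [jetFun, if_neg hm.not_isAddUnit, if_pos hm] at this
    by_cases hd : ∃ d, m = h + d
    · exact ⟨1, 1, by simpa [HasLeadingTerm, hd] using this, by simp [hd]⟩
    · exact ⟨0, 1, by simpa [HasLeadingTerm, hd] using this, by simp [hd]⟩
  -- Leading terms multiply, so splitting `m` into nonunits of smaller length reduces to
  -- irreducibles and units. Only one implication about `i` is carried along: a positive exponent of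
  -- `x` must come from a summand divisible by `h`.
  have hlead : ∀ (N : ℕ) (m : P), ℓ m = N →
      ∃ i d, HasLeadingTerm (φ (single m 1)) i d ∧ (i ≠ 0 → ∃ d, m = h + d) := by
    intro N
    induction N using Nat.strong_induction_on with
    | _ N ih =>
      intro m hm
      by_cases hu : IsAddUnit m
      · refine ⟨0, 0, ?_, by simp⟩
        have := hφ m
        rw [jetFun_of_isAddUnit hu] at this
        have := (pow_dvd_pow PowerSeries.X one_le_two).trans this
        simpa [HasLeadingTerm] using this
      rcases addIrreducible_or_factor hu with hm' | ⟨m₁, m₂, h₁, h₂, rfl⟩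
      · obtain ⟨i, d, h1, h2⟩ := hirr m hm'
        exact ⟨i, d, h1, h2.1⟩
      rw [map_add] at hm
      have e₁ : ℓ m₁ ≠ 0 := fun h => h₁ (hℓ _ h)
      have e₂ : ℓ m₂ ≠ 0 := fun h => h₂ (hℓ _ h)
      obtain ⟨i, d, hl, hi⟩ := ih (ℓ m₁) (by omega) m₁ rfl
      obtain ⟨j, e, hl', hj⟩ := ih (ℓ m₂) (by omega) m₂ rfl
      refine ⟨i + j, d + e, ?_, fun hij => ?_⟩
      · rw [← mul_one (1 : k), ← single_mul_single, map_mul]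
        exact hl.mul hl'
      · rcases Nat.eq_zero_or_pos i with rfl | hi0
        · obtain ⟨d, rfl⟩ := hj (by omega)
          exact ⟨m₁ + d, add_left_comm _ _ _⟩
        · obtain ⟨d, rfl⟩ := hi hi0.ne'
          exact ⟨d + m₂, add_assoc _ _ _⟩
  obtain ⟨ia, da, ha, ha'⟩ := hlead _ a rfl
  obtain ⟨ib, db, hb, hb'⟩ := hlead _ b rfl
  obtain ⟨ic, dc, hc, -⟩ := hlead _ c rfl
  obtain ⟨ih, dh, hh, hh'⟩ := hirr h hh
  have h0 := hh'.2 ⟨0, (add_zero h).symm⟩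
  -- Both sides of `a + b = h + c` give the same power of `x`, so `ia + ib = ih + ic`. As `ih ≠ 0`,
  -- one of `ia`, `ib` is nonzero.
  have := (ha.mul hb).unique (i := ia + ib) (j := ih + ic) (e := dh + dc) (by
    rw [← map_mul, single_mul_single, habc, ← single_mul_single, map_mul]
    exact hh.mul hc)
  by_contra! hcon
  have : ia = 0 := by
    by_contra h
    obtain ⟨d, hd⟩ := ha' h
    exact hcon.1 d hd
  have : ib = 0 := by
    by_contra h
    obtain ⟨d, hd⟩ := hb' h
    exact hcon.2 d hd
  omega

end Smooth

/-! ### Ideal sheaves on affine charts and their local comparison. -/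

section IdealSheaf

variable {X Y : Scheme.{u}} {R : CommRingCat.{u}}

/-- The ideal of `R` corresponding to an ideal sheaf on `Spec R`. -/
def toIdeal (J : (Spec R).IdealSheafData) : Ideal R :=
  (J.ideal ⟨⊤, isAffineOpen_top _⟩).map (Scheme.ΓSpecIso R).hom.hom

lemma map_iso_hom_le_iff {A B : CommRingCat.{u}} (e : A ≅ B) (I J : Ideal A) :
    I.map e.hom.hom ≤ J.map e.hom.hom ↔ I ≤ J := by
  refine ⟨fun h => ?_, fun h => Ideal.map_mono h⟩
  have := Ideal.map_mono (f := e.inv.hom) h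
  simpa [Ideal.map_map, ← CommRingCat.hom_comp, Ideal.map_id] using this

lemma toIdeal_le_iff {J J' : (Spec R).IdealSheafData} : toIdeal J ≤ toIdeal J' ↔ J ≤ J' := by
  rw [toIdeal, toIdeal, map_iso_hom_le_iff]
  exact ⟨Scheme.IdealSheafData.le_of_isAffine, fun h => h _⟩

lemma toIdeal_injective : Function.Injective (toIdeal (R := R)) := fun _ _ h =>
  le_antisymm (toIdeal_le_iff.1 h.le) (toIdeal_le_iff.1 h.ge)

lemma toIdeal_surjective : Function.Surjective (toIdeal (R := R)) := fun I => by
  refine ⟨.ofIdealTop (I.map (Scheme.ΓSpecIso R).inv.hom), ?_⟩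
  simp [toIdeal, Ideal.map_map, ← CommRingCat.hom_comp, Ideal.map_id]

lemma map_iso_hom_eq_comap {A B : CommRingCat.{u}} (e : A ≅ B) (I : Ideal A) :
    I.map e.hom.hom = I.comap e.inv.hom :=
  Ideal.map_comap_of_equiv e.commRingCatIsoToRingEquiv

lemma toIdeal_map {S : CommRingCat.{u}} (φ : R ⟶ S) (J : (Spec S).IdealSheafData) :
    toIdeal (J.map (Spec.map φ)) = (toIdeal J).comap φ.hom := by
  rw [toIdeal, toIdeal, Scheme.IdealSheafData.ideal_map_of_isAffineHom, map_iso_hom_eq_comap,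
    map_iso_hom_eq_comap, Ideal.comap_comap, Ideal.comap_comap, ← CommRingCat.hom_comp,
    ← CommRingCat.hom_comp]
  have := Scheme.ΓSpecIso_inv_naturality φ
  rw [this]
  rfl

/-- Inverse image of ideal sheaves and extension of ideals are left adjoint to `map` and to
contraction, which correspond by `toIdeal_map`. -/
lemma toIdeal_comap {S : CommRingCat.{u}} (φ : R ⟶ S) (J : (Spec R).IdealSheafData) :
    toIdeal (J.comap (Spec.map φ)) = (toIdeal J).map φ.hom := by
  refine eq_of_forall_ge_iff fun I => ?_
  obtain ⟨I, rfl⟩ := toIdeal_surjective I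
  rw [toIdeal_le_iff, ← Scheme.IdealSheafData.le_map_iff_comap_le, Ideal.map_le_iff_le_comap,
    ← toIdeal_map, toIdeal_le_iff]

/-- The ideal of `R` obtained by restricting an ideal sheaf along `Spec R ⟶ X`. -/
def affineIdeal (f : Spec R ⟶ X) (I : X.IdealSheafData) : Ideal R := toIdeal (I.comap f)

variable (f : Spec R ⟶ X) [IsOpenImmersion f]

/-- The sections of `𝒪_X` on the image of an open immersion `Spec R ⟶ X`. -/
def sectionsIso : Γ(X, f ''ᵁ ⊤) ≅ R := f.appIso ⊤ ≪≫ Scheme.ΓSpecIso R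

lemma affineIdeal_eq_map (I : X.IdealSheafData) :
    affineIdeal f I = (I.ideal ⟨f ''ᵁ ⊤, (isAffineOpen_top _).image_of_isOpenImmersion f⟩).map
      (sectionsIso f).hom.hom := by
  rw [affineIdeal, toIdeal, Scheme.IdealSheafData.ideal_comap_of_isOpenImmersion,
    sectionsIso, Iso.trans_hom, CommRingCat.hom_comp, ← Ideal.map_map,
    map_iso_hom_eq_comap (f.appIso ⊤)]

lemma affineIdeal_top : affineIdeal f ⊤ = ⊤ := by
  simp [affineIdeal_eq_map, Ideal.map_top]

lemma affineIdeal_mul (I J : X.IdealSheafData) :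
    affineIdeal f (I * J) = affineIdeal f I * affineIdeal f J := by
  simp [affineIdeal_eq_map, Ideal.map_mul]

lemma affineIdeal_pow (I : X.IdealSheafData) (e : ℕ) :
    affineIdeal f (I ^ e) = affineIdeal f I ^ e := by
  simp [affineIdeal_eq_map, Ideal.map_pow]

lemma affineIdeal_iSup {ι : Type*} (I : ι → X.IdealSheafData) :
    affineIdeal f (⨆ i, I i) = ⨆ i, affineIdeal f (I i) := by
  simp [affineIdeal_eq_map, Ideal.map_iSup]

lemma affineIdeal_prod {ι : Type*} (s : Finset ι) (I : ι → X.IdealSheafData) :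
    affineIdeal f (∏ i ∈ s, I i) = ∏ i ∈ s, affineIdeal f (I i) := by
  classical
  induction s using Finset.induction_on with
  | empty => simpa using affineIdeal_top f
  | insert a s ha ih => rw [Finset.prod_insert ha, Finset.prod_insert ha, affineIdeal_mul, ih]

/-- Radical ideals stay radical under restriction to an open subscheme, and a radical ideal sheaf is
the vanishing ideal of its support. -/
lemma vanishingIdeal_comap (Z : Closeds X) :
    (Scheme.IdealSheafData.vanishingIdeal Z).comap f =
      Scheme.IdealSheafData.vanishingIdeal (Z.preimage f.continuous) := by
  have h : (((Scheme.IdealSheafData.vanishingIdeal Z).comap f)).radical =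
      (Scheme.IdealSheafData.vanishingIdeal Z).comap f := by
    ext U : 2
    rw [Scheme.IdealSheafData.radical_ideal]
    refine Ideal.IsRadical.radical ?_
    rw [Scheme.IdealSheafData.ideal_comap_of_isOpenImmersion]
    refine Ideal.IsRadical.comap _ ?_
    exact PrimeSpectrum.isRadical_vanishingIdeal _
  rw [← h, ← Scheme.IdealSheafData.vanishingIdeal_support]
  congr 1
  rw [Scheme.IdealSheafData.support_comap]
  rfl

lemma support_eq_zeroLocus (J : (Spec R).IdealSheafData) :
    (J.support : Set (Spec R)) = PrimeSpectrum.zeroLocus (toIdeal J : Set R) := by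
  have h := J.coe_support_inter ⟨⊤, isAffineOpen_top _⟩
  rw [Opens.coe_top, Set.inter_univ, Set.inter_univ] at h
  rw [h, AlgebraicGeometry.Spec_zeroLocus, toIdeal, map_iso_hom_eq_comap]
  rfl

lemma mem_toIdeal_vanishingIdeal {Z : Closeds (Spec R)} {r : R} :
    r ∈ toIdeal (Scheme.IdealSheafData.vanishingIdeal Z) ↔ ∀ p : Spec R, p ∈ Z → r ∈ p.asIdeal := by
  let V : Set (PrimeSpectrum R) := {p | (show Spec R from p) ∈ Z}
  have : toIdeal (Scheme.IdealSheafData.vanishingIdeal Z) = PrimeSpectrum.vanishingIdeal V := by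
    refine eq_of_forall_le_iff fun I => ?_
    obtain ⟨I, rfl⟩ := toIdeal_surjective I
    rw [toIdeal_le_iff, ← Scheme.IdealSheafData.le_support_iff_le_vanishingIdeal,
      ← PrimeSpectrum.subset_zeroLocus_iff_le_vanishingIdeal, ← SetLike.coe_subset_coe]
    exact iff_of_eq (congrArg ((Z : Set (Spec R)) ⊆ ·) (support_eq_zeroLocus I))
  rw [this]
  exact PrimeSpectrum.mem_vanishingIdeal _ _

lemma mem_affineIdeal_vanishingIdeal {Z : Closeds X} {r : R} :
    r ∈ affineIdeal f (Scheme.IdealSheafData.vanishingIdeal Z) ↔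
      ∀ p : Spec R, f p ∈ Z → r ∈ p.asIdeal := by
  rw [affineIdeal, vanishingIdeal_comap, mem_toIdeal_vanishingIdeal]
  exact Iff.rfl

/-- Two ideal sheaves agree in a neighbourhood of a point. -/
def AgreeAt (I J : X.IdealSheafData) (x : X) : Prop :=
  ∃ U : X.affineOpens, x ∈ U.1 ∧ I.ideal U = J.ideal U

lemma ideal_eq_of_le {I J : X.IdealSheafData} {U V : X.affineOpens} (h : U ≤ V)
    (hV : I.ideal V = J.ideal V) : I.ideal U = J.ideal U := by
  rw [← I.map_ideal h, ← J.map_ideal h, hV]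

lemma AgreeAt.symm {I J : X.IdealSheafData} {x : X} (h : AgreeAt I J x) : AgreeAt J I x := by
  obtain ⟨U, hx, hU⟩ := h
  exact ⟨U, hx, hU.symm⟩

lemma AgreeAt.trans {I J K : X.IdealSheafData} {x : X} (h : AgreeAt I J x) (h' : AgreeAt J K x) :
    AgreeAt I K x := by
  obtain ⟨U, hx, hU⟩ := h
  obtain ⟨V, hx', hV⟩ := h'
  obtain ⟨_, ⟨W, hW, rfl⟩, hxW, hle⟩ := X.isBasis_affineOpens.exists_subset_of_mem_open
    (show x ∈ (U.1 ⊓ V.1 : X.Opens) from ⟨hx, hx'⟩) (U.1 ⊓ V.1).2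
  have h1 : (⟨W, hW⟩ : X.affineOpens) ≤ U := fun y hy => (hle hy).1
  have h2 : (⟨W, hW⟩ : X.affineOpens) ≤ V := fun y hy => (hle hy).2
  exact ⟨⟨W, hW⟩, hxW, (ideal_eq_of_le h1 hU).trans (ideal_eq_of_le h2 hV)⟩

lemma AgreeAt.of_specializes {I J : X.IdealSheafData} {x y : X} (h : AgreeAt I J x) (hy : y ⤳ x) :
    AgreeAt I J y := by
  obtain ⟨U, hx, hU⟩ := h
  exact ⟨U, hy.mem_open U.1.2 hx, hU⟩

lemma eq_of_agreeAt {I J : X.IdealSheafData} (h : ∀ x, AgreeAt I J x) : I = J := by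
  choose U hx hU using h
  exact Scheme.IdealSheafData.ext_of_iSup_eq_top U
    (top_le_iff.1 fun x _ => Opens.mem_iSup.2 ⟨x, hx x⟩) hU

lemma agreeAt_comap_iff (g : Y ⟶ X) [IsOpenImmersion g] {I J : X.IdealSheafData} {y : Y} :
    AgreeAt (I.comap g) (J.comap g) y ↔ AgreeAt I J (g y) := by
  constructor
  · rintro ⟨U, hy, hU⟩
    refine ⟨⟨g ''ᵁ U, U.2.image_of_isOpenImmersion g⟩, ⟨y, hy, rfl⟩, ?_⟩
    rw [Scheme.IdealSheafData.ideal_comap_of_isOpenImmersion,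
      Scheme.IdealSheafData.ideal_comap_of_isOpenImmersion] at hU
    exact Ideal.comap_injective_of_surjective _
      (g.appIso U).symm.commRingCatIsoToRingEquiv.surjective hU
  · rintro ⟨U, hy, hU⟩
    obtain ⟨_, ⟨W, hW, rfl⟩, hxW, hle⟩ := Y.isBasis_affineOpens.exists_subset_of_mem_open
      (show y ∈ g ⁻¹ᵁ U.1 from hy) (g ⁻¹ᵁ U.1).2
    refine ⟨⟨W, hW⟩, hxW, ?_⟩
    rw [Scheme.IdealSheafData.ideal_comap_of_isOpenImmersion,
      Scheme.IdealSheafData.ideal_comap_of_isOpenImmersion]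
    congr 1
    refine ideal_eq_of_le (V := U) ?_ hU
    rintro _ ⟨z, hz, rfl⟩
    exact hle hz

lemma comap_eq_comap_iff (g : Y ⟶ X) [IsOpenImmersion g] {I J : X.IdealSheafData} :
    I.comap g = J.comap g ↔ ∀ y, AgreeAt I J (g y) := by
  constructor
  · intro h y
    rw [← agreeAt_comap_iff, h]
    obtain ⟨_, ⟨W, hW, rfl⟩, hxW, -⟩ := Y.isBasis_affineOpens.exists_subset_of_mem_open
      (Set.mem_univ y) isOpen_univ
    exact ⟨⟨W, hW⟩, hxW, rfl⟩
  · exact fun h => eq_of_agreeAt fun y => (agreeAt_comap_iff g).2 (h y)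

lemma affineIdeal_eq_iff {I J : X.IdealSheafData} :
    affineIdeal f I = affineIdeal f J ↔ ∀ p, AgreeAt I J (f p) :=
  toIdeal_injective.eq_iff.trans (comap_eq_comap_iff f)

lemma eq_of_openCover (𝒰 : X.OpenCover) {I J : X.IdealSheafData}
    (h : ∀ i, I.comap (𝒰.f i) = J.comap (𝒰.f i)) : I = J := by
  refine eq_of_agreeAt fun x => ?_
  obtain ⟨i, y, rfl⟩ := 𝒰.exists_eq x
  exact (comap_eq_comap_iff (𝒰.f i)).1 (h i) y

/-- The two ideals agree on a basic open `D(s)` around `p`; membership in a localized ideal becomes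
membership in the ideal after multiplying by a power of `s`. This supplies the hypothesis of
`IsMonomial.le_of_forall_exists`. -/
lemma AgreeAt.exists_mul_mem {I J : X.IdealSheafData} {p : Spec R} (h : AgreeAt I J (f p)) {r : R}
    (hr : r ∈ affineIdeal f I) : ∃ s ∉ p.asIdeal, s * r ∈ affineIdeal f J := by
  rw [← agreeAt_comap_iff] at h
  obtain ⟨U, hpU, hU⟩ := h
  obtain ⟨_, ⟨s, rfl⟩, hps, hsU⟩ :=
    PrimeSpectrum.isTopologicalBasis_basic_opens.exists_subset_of_mem_open hpU U.1.2
  let V : (Spec R).affineOpens := ⟨⊤, isAffineOpen_top _⟩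
  let s' : Γ(Spec R, V.1) := (Scheme.ΓSpecIso R).inv s
  have hle : (Spec R).affineBasicOpen s' ≤ U := by
    intro x hx
    exact hsU ((basicOpen_eq_of_affine s).le hx)
  have hD := ideal_eq_of_le hle hU
  rw [← Scheme.IdealSheafData.map_ideal_basicOpen, ← Scheme.IdealSheafData.map_ideal_basicOpen]
    at hD
  have hloc : IsLocalization.Away s' Γ(Spec R, (Spec R).basicOpen s') :=
    V.2.isLocalization_basicOpen s'
  have hr' : (Scheme.ΓSpecIso R).inv r ∈ (I.comap f).ideal V := by
    rw [affineIdeal, toIdeal, map_iso_hom_eq_comap] at hr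
    exact hr
  have h1 := Ideal.mem_map_of_mem ((Spec R).presheaf.map
    (homOfLE ((Spec R).basicOpen_le s')).op).hom hr'
  have h2 := hD.le h1
  have h3 := (IsLocalization.algebraMap_mem_map_algebraMap_iff (Submonoid.powers s')
    Γ(Spec R, (Spec R).basicOpen s') _ _).1 h2
  obtain ⟨_, ⟨N, rfl⟩, hN⟩ := h3
  refine ⟨s ^ N, fun h => hps (p.2.mem_of_pow_mem N h), ?_⟩
  rw [affineIdeal, toIdeal, map_iso_hom_eq_comap, Ideal.mem_comap, map_mul, map_pow]
  exact hN

end IdealSheaf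

variable (k : Type u) [Field k] {n : ℕ} (F : Fan n)

/-! ### Geometry of the charts: lengths, boundary, orbits. -/

section Charts

instance (σ : PointedCone ℝ (Fin n → ℝ)) : IsDomain (CoordRing k σ) := by
  have hinj : Function.Injective (AddMonoidAlgebra.mapDomainRingHom k (dualMonoid σ).subtype) :=
    AddMonoidAlgebra.mapDomain_injective Subtype.val_injective
  exact hinj.isDomain _

/-- The length is the pairing with the sum of finitely many lattice generators of `σ`. If it
vanishes, `m` vanishes on each generator, hence on `σ`, and `-m` is a character of the chart too. It
serves for inductions on factorizations. -/
lemma exists_length {σ : PointedCone ℝ (Fin n → ℝ)} (hσ : IsRationalPolyhedral σ) :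
    ∃ ℓ : dualMonoid σ →+ ℕ, ∀ m, ℓ m = 0 → IsAddUnit m := by
  obtain ⟨s, hs⟩ := hσ
  have hint (m u : Fin n → ℤ) : pairing m (fun i => (u i : ℝ)) = ((∑ i, m i * u i : ℤ) : ℝ) := by
    simp [pairing]
  have hnn : ∀ m : dualMonoid σ, ∀ u ∈ s, 0 ≤ ∑ i, m.1 i * u i := by
    intro m u hu
    have := m.2 (fun i => (u i : ℝ)) (by rw [hs]; exact Submodule.subset_span ⟨u, hu, rfl⟩)
    rw [hint] at this
    exact_mod_cast this
  have hnn' : ∀ m : dualMonoid σ, 0 ≤ ∑ u ∈ s, ∑ i, m.1 i * u i := fun m =>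
    Finset.sum_nonneg (hnn m)
  refine ⟨⟨⟨fun m => (∑ u ∈ s, ∑ i, m.1 i * u i).toNat, by simp⟩, fun a b => ?_⟩, fun m hm => ?_⟩
  · rw [← Int.toNat_add (hnn' a) (hnn' b), ← Finset.sum_add_distrib]
    simp only [← Finset.sum_add_distrib, AddSubmonoid.coe_add, Pi.add_apply, add_mul]
  · have h0 : ∑ u ∈ s, ∑ i, m.1 i * u i = 0 := le_antisymm (Int.toNat_eq_zero.1 hm) (hnn' m)
    have h1 := (Finset.sum_eq_zero_iff_of_nonneg (hnn m)).1 h0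
    have hneg : -m.1 ∈ dualMonoid σ := by
      intro v hv
      rw [hs] at hv
      induction hv using Submodule.span_induction with
      | mem x hx =>
        obtain ⟨u, hu, rfl⟩ := hx
        rw [hint]
        simp [h1 u hu]
      | zero => simp [pairing]
      | add x y _ _ hx hy =>
        rw [pairing_add_right]
        exact add_nonneg hx hy
      | smul a x _ hx =>
        have : a • x = (a : ℝ) • x := rfl
        rw [this, pairing_smul_right]
        exact mul_nonneg a.2 hx
    exact IsAddUnit.of_add_eq_zero ⟨-m.1, hneg⟩ (Subtype.ext (add_neg_cancel m.1))

lemma formallySmooth_coordRing (hX : Smooth (toSpec k F)) (σ : F.cones) :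
    Algebra.FormallySmooth k (CoordRing k σ.1) := by
  have h : Smooth (chartToSpec k σ.1) := by
    rw [← ι_toSpec]
    infer_instance
  have h := (HasRingHomProperty.Spec_iff (P := @Smooth)).1 h
  have : Algebra.Smooth k (CoordRing k σ.1) := RingHom.smooth_algebraMap.1 h
  infer_instance

variable {k F} in
lemma ι_specializes_iff {σ : F.cones} {p q : chart k σ.1} :
    ι k F σ p ⤳ ι k F σ q ↔ p.asIdeal ≤ q.asIdeal := by
  rw [(ι k F σ).isOpenEmbedding.isInducing.specializes_iff]
  exact (PrimeSpectrum.le_iff_specializes p q).symm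

variable {k F} in
lemma exists_of_specializes {σ : F.cones} {q : chart k σ.1} {z : X k F} (h : z ⤳ ι k F σ q) :
    ∃ p, ι k F σ p = z :=
  h.mem_open (ι k F σ).isOpenEmbedding.isOpen_range ⟨q, rfl⟩

lemma exists_chart (y : X k F) : ∃ (σ : F.cones) (q : chart k σ.1), ι k F σ q = y :=
  (chartCover k F).exists_eq y

variable {k F} in
lemma mem_range_chartMap_of_notMem {σ τ : F.cones} (h : τ ≤ σ) (m : dualMonoid σ.1)
    (hτ : ∀ v, v ∈ τ.1 ↔ v ∈ σ.1 ∧ pairing m.1 v = 0) {q : chart k σ.1}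
    (hq : AddMonoidAlgebra.single m 1 ∉ q.asIdeal) : ∃ p : chart k τ.1, chartMap k h p = q := by
  have : q ∈ Set.range (chartMap k h) := by
    rw [range_chartMap k h (F.rational _ σ.2) m hτ]
    exact hq
  exact this

lemma ι_chartMap {σ τ : F.cones} (h : τ ≤ σ) (p : chart k τ.1) :
    ι k F σ (chartMap k h p) = ι k F τ p := by
  rw [← Scheme.Hom.comp_apply, chartMap_ι]

variable {k F} in
-- The zero cone is the face of `σ` cut out by a single character, so the torus is a basic open
-- subset of `U_σ`; on it every monomial is invertible.
lemma ι_mem_boundary_iff {σ : F.cones} {q : chart k σ.1} :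
    ι k F σ q ∈ boundary k F ↔ ∃ m, AddMonoidAlgebra.single m 1 ∈ q.asIdeal := by
  have hle : (⟨⊥, F.bot_mem⟩ : F.cones) ≤ σ := (bot_le : ⊥ ≤ σ.1)
  rw [boundary, Set.mem_compl_iff, not_iff_comm]
  constructor
  · intro h
    push Not at h
    obtain ⟨m, hm, hm'⟩ := F.isFace_of_le hle
    obtain ⟨p, hp⟩ := mem_range_chartMap_of_notMem hle ⟨m, hm⟩ hm' (h ⟨m, hm⟩)
    exact ⟨p, by rw [← hp, ι_chartMap]⟩
  · rintro ⟨p, hp⟩ ⟨m, hm⟩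
    rw [← ι_chartMap k F hle] at hp
    obtain rfl := (ι k F σ).isOpenEmbedding.injective hp
    have hm' : coordRingMap k hle (AddMonoidAlgebra.single m 1) ∈ p.asIdeal := hm
    rw [coordRingMap_single] at hm'
    refine p.2.ne_top (Ideal.eq_top_of_isUnit_mem _ hm' (isUnit_single ?_))
    have hmem : ∀ m' : Fin n → ℤ, m' ∈ dualMonoid (⊥ : PointedCone ℝ (Fin n → ℝ)) := by
      intro m' v hv
      rw [(Submodule.mem_bot _).1 hv]
      simp [pairing]
    exact IsAddUnit.of_add_eq_zero ⟨-m.1, hmem _⟩ (Subtype.ext (add_neg_cancel m.1))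

lemma isClosed_boundary : IsClosed (boundary k F) :=
  (ι k F ⟨⊥, F.bot_mem⟩).isOpenEmbedding.isOpen_range.isClosed_compl

/-- The face of `σ` cut out by a character `m`. -/
def faceOf (σ : PointedCone ℝ (Fin n → ℝ)) (m : Fin n → ℤ) : PointedCone ℝ (Fin n → ℝ) where
  carrier := {v | v ∈ σ ∧ pairing m v = 0}
  zero_mem' := ⟨σ.zero_mem, by simp [pairing]⟩
  add_mem' {a b} ha hb := ⟨σ.add_mem ha.1 hb.1, by rw [pairing_add_right, ha.2, hb.2, add_zero]⟩
  smul_mem' c v hv := ⟨Submodule.smul_mem σ c hv.1, by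
    have : c • v = (c : ℝ) • v := rfl
    rw [this, pairing_smul_right, hv.2, mul_zero]⟩

/-- Every point of a chart lies in the closed orbit of a smaller chart. -/
lemma exists_le_nonunitIdeal_le {σ : F.cones} (q : chart k σ.1) :
    ∃ (τ : F.cones) (_ : τ ≤ σ) (p : chart k τ.1), ι k F τ p = ι k F σ q ∧
      nonunitIdeal k (dualMonoid τ.1) ≤ p.asIdeal := by
  have : Finite F.cones := F.finite
  -- Take a minimal cone whose chart contains the point. If a noninvertible `χ^m` did not vanish
  -- there, the point would lie in the chart of the face `m = 0`; minimality makes this face all of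
  -- `τ`, so that `-m` is also nonnegative on `τ`.
  obtain ⟨τ, hτ, hmin⟩ := (wellFounded_lt (α := F.cones)).has_min
    {τ | τ ≤ σ ∧ ∃ p, ι k F τ p = ι k F σ q} ⟨σ, le_rfl, q, rfl⟩
  obtain ⟨hle, p, hp⟩ := hτ
  refine ⟨τ, hle, p, hp, monomialIdeal_le.2 fun m hm => ?_⟩
  by_contra hmp
  have hface : IsFace (faceOf τ.1 m.1) τ.1 := ⟨m.1, m.2, fun v => Iff.rfl⟩
  let ρ : F.cones := ⟨_, F.face_mem _ τ.2 _ hface⟩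
  have hρ : ρ ≤ τ := hface.le
  obtain ⟨p', hp'⟩ := mem_range_chartMap_of_notMem hρ m (fun v => Iff.rfl) hmp
  have hρτ : τ ≤ ρ := by
    by_contra hlt
    exact hmin ρ ⟨hρ.trans hle, p', by rw [← hp, ← hp', ι_chartMap]⟩ (lt_of_le_not_ge hρ hlt)
  refine hm (IsAddUnit.of_add_eq_zero ⟨-m.1, fun v hv => ?_⟩ (Subtype.ext (add_neg_cancel m.1)))
  have h0 : pairing m.1 v = 0 := (hρτ hv).2
  have h1 : pairing (m.1 + -m.1) v = 0 := by rw [add_neg_cancel, pairing_zero]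
  rw [pairing_add, h0, zero_add] at h1
  exact h1.ge

/-- The generic point of the closed orbit of the chart `U_σ`. -/
def orbitPoint (σ : F.cones) : chart k σ.1 :=
  (⟨nonunitIdeal k (dualMonoid σ.1), inferInstance⟩ : PrimeSpectrum (CoordRing k σ.1))

/-- Units of `σ^∨ ∩ M` remain units in the larger monoid `τ^∨ ∩ M`, so the nonunit ideal of `τ`
contracts into that of `σ`. -/
lemma orbitPoint_specializes {σ τ : F.cones} (h : τ ≤ σ) :
    ι k F τ (orbitPoint k F τ) ⤳ ι k F σ (orbitPoint k F σ) := by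
  rw [← ι_chartMap k F h, ι_specializes_iff]
  intro f hf
  have hf : coordRingMap k h f ∈ nonunitIdeal k (dualMonoid τ.1) := hf
  change f ∈ nonunitIdeal k (dualMonoid σ.1)
  rw [mem_nonunitIdeal] at hf ⊢
  intro m hm hu
  refine hf (AddSubmonoid.inclusion (dualMonoid_anti h) m) ?_ (hu.map _)
  rw [Finsupp.mem_support_iff] at hm ⊢
  have : (coordRingMap k h f).coeff (AddSubmonoid.inclusion (dualMonoid_anti h) m) = f.coeff m :=
    Finsupp.mapDomain_apply (AddSubmonoid.inclusion_injective _) _ _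
  rwa [this]

end Charts

/-! ### Invariance under the coaction, algebraically. -/

section Coaction

variable {k}

/-- The coefficient of `χ^m` in `k[M] ⊗ A`. -/
def tensorCoeff (A : Type*) [AddCommGroup A] [Module k A] (m : Fin n → ℤ) :
    AddMonoidAlgebra k (Fin n → ℤ) ⊗[k] A →ₗ[k] A :=
  TensorProduct.lift
    { toFun := fun f => f.coeff m • LinearMap.id
      map_add' := fun f g => by simp [add_smul]
      map_smul' := fun c f => by simp [mul_smul] }

@[simp] lemma tensorCoeff_tmul (A : Type*) [AddCommGroup A] [Module k A] (m : Fin n → ℤ)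
    (f : AddMonoidAlgebra k (Fin n → ℤ)) (a : A) : tensorCoeff A m (f ⊗ₜ a) = f.coeff m • a := by
  simp [tensorCoeff]

lemma tensorCoeff_coaction {σ : PointedCone ℝ (Fin n → ℝ)} (m : dualMonoid σ) (f : CoordRing k σ) :
    tensorCoeff _ m.1 (coaction k σ f) = AddMonoidAlgebra.single m (f.coeff m) := by
  induction f using AddMonoidAlgebra.induction_linear with
  | zero => simp
  | add f g hf hg => simp [map_add, hf, hg]
  | single a r =>
    have : AddMonoidAlgebra.single a r = r • AddMonoidAlgebra.single a (1 : k) := by simp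
    rw [this, map_smul, map_smul, coaction_single, tensorCoeff_tmul]
    by_cases h : a = m
    · subst h
      simp
    · have h' : a.1 ≠ m.1 := fun e => h (Subtype.ext e)
      simp [h, h']

lemma map_coaction_eq_iff {σ : PointedCone ℝ (Fin n → ℝ)} (J : Ideal (CoordRing k σ)) :
    J.map (coaction k σ).toRingHom = J.map (Algebra.TensorProduct.includeRight :
      CoordRing k σ →ₐ[k] AddMonoidAlgebra k (Fin n → ℤ) ⊗[k] CoordRing k σ).toRingHom ↔
        IsMonomial J := by
  constructor
  · intro h f hf m hm
    have h1 : coaction k σ f ∈ J.map (Algebra.TensorProduct.includeRight :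
        CoordRing k σ →ₐ[k] AddMonoidAlgebra k (Fin n → ℤ) ⊗[k] CoordRing k σ) :=
      h.le (Ideal.mem_map_of_mem _ hf)
    have h2 : coaction k σ f ∈ LinearMap.range (LinearMap.lTensor (AddMonoidAlgebra k (Fin n → ℤ))
        (Submodule.subtype (J.restrictScalars k))) := by
      rw [← Ideal.map_includeRight_eq]
      exact h1
    obtain ⟨y, hy⟩ := h2
    -- The extension of `J` is the image of `k[M] ⊗ J`, on which every coefficient map takes values
    -- in `J`.
    have h3 : tensorCoeff _ m.1 (coaction k σ f) ∈ J := by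
      rw [← hy]
      clear hy
      induction y using TensorProduct.induction_on with
      | zero => simp
      | tmul a b =>
        rw [LinearMap.lTensor_tmul, tensorCoeff_tmul]
        exact (J.restrictScalars k).smul_mem _ b.2
      | add x y hx hy =>
        rw [map_add, map_add]
        exact J.add_mem hx hy
    rw [tensorCoeff_coaction] at h3
    have := (J.restrictScalars k).smul_mem (f.coeff m)⁻¹ h3
    rwa [AddMonoidAlgebra.smul_single, smul_eq_mul,
      inv_mul_cancel₀ (Finsupp.mem_support_iff.1 hm)] at this
  · intro h
    have key : ∀ m : dualMonoid σ, (coaction k σ).toRingHom (AddMonoidAlgebra.single m 1) =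
        (AddMonoidAlgebra.single m.1 1 ⊗ₜ[k] 1) *
          Algebra.TensorProduct.includeRight.toRingHom (AddMonoidAlgebra.single m 1) := by
      intro m
      refine (coaction_single k σ m).trans ?_
      simp
    refine le_antisymm (Ideal.map_le_iff_le_comap.2 ?_) (Ideal.map_le_iff_le_comap.2 ?_)
    · rw [h.eq, monomialIdeal_le]
      intro m hm
      rw [Ideal.mem_comap, key, ← h.eq]
      exact Ideal.mul_mem_left _ _ (Ideal.mem_map_of_mem _ hm)
    · rw [h.eq, monomialIdeal_le]
      intro m hm
      rw [Ideal.mem_comap, ← h.eq]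
      -- `χ^m ⊗ 1` is invertible because `-m` is a character of the torus, even if not of the chart.
      have hm' := Ideal.mul_mem_left _ (AddMonoidAlgebra.single (-m.1) 1 ⊗ₜ[k] 1)
        (Ideal.mem_map_of_mem (coaction k σ).toRingHom hm)
      rw [key, ← mul_assoc, Algebra.TensorProduct.tmul_mul_tmul,
        AddMonoidAlgebra.single_mul_single, neg_add_cancel, mul_one, mul_one,
        ← AddMonoidAlgebra.one_def, ← Algebra.TensorProduct.one_def, one_mul] at hm'
      exact hm'

end Coaction

/-! ### Torus invariance as monomiality on the charts. -/

section Invariance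

lemma comap_injective_of_isIso {X Y : Scheme.{u}} (e : X ≅ Y) {I J : Y.IdealSheafData}
    (h : I.comap e.hom = J.comap e.hom) : I = J := by
  have := congrArg (·.comap e.inv) h
  simpa only [← Scheme.IdealSheafData.comap_comp, Iso.inv_hom_id,
    Scheme.IdealSheafData.comap_id] using this

lemma comap_chartAction_eq_iff {σ : PointedCone ℝ (Fin n → ℝ)} (J : (chart k σ).IdealSheafData) :
    J.comap (chartAction k σ) = J.comap (pullback.snd (torusToSpec k n) (chartToSpec k σ)) ↔
      IsMonomial (k := k) (toIdeal J) := by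
  have hsnd : pullback.snd (torusToSpec k n) (chartToSpec k σ) =
      (pullbackSpecIso k (AddMonoidAlgebra k (Fin n → ℤ)) (CoordRing k σ)).hom ≫
        Spec.map (CommRingCat.ofHom (Algebra.TensorProduct.includeRight :
      CoordRing k σ →ₐ[k] AddMonoidAlgebra k (Fin n → ℤ) ⊗[k] CoordRing k σ).toRingHom) :=
    (pullbackSpecIso_hom_snd _ _ _).symm
  rw [hsnd, chartAction, Scheme.IdealSheafData.comap_comp, Scheme.IdealSheafData.comap_comp,
    ← map_coaction_eq_iff]
  refine ⟨fun h => ?_, fun h => congrArg (Scheme.IdealSheafData.comap · _) (toIdeal_injective ?_)⟩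
  · have := congrArg toIdeal (comap_injective_of_isIso _ h)
    rw [toIdeal_comap, toIdeal_comap] at this
    exact this
  · rw [toIdeal_comap, toIdeal_comap]
    exact h

/-- The inclusion `T ×ₖ U_σ ⟶ T ×ₖ X`. -/
abbrev torusChart (σ : F.cones) : pullback (torusToSpec k n) (chartToSpec k σ.1) ⟶
    pullback (torusToSpec k n) (toSpec k F) :=
  pullback.map (torusToSpec k n) (chartToSpec k σ.1) (torusToSpec k n) (toSpec k F)
      (𝟙 _) (ι k F σ) (𝟙 _) (by simp) (by simp [ι_toSpec])

/-- An ideal sheaf on a toric variety is toric if and only if it is monomial on the charts. -/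
theorem isToric_iff (I : (X k F).IdealSheafData) :
    IsToric k F I ↔ ∀ σ : F.cones, IsMonomial (k := k) (affineIdeal (ι k F σ) I) := by
  have hj : ∀ σ : F.cones, (I.comap (action k F)).comap (torusChart k F σ) =
      (I.comap (pullback.snd (torusToSpec k n) (toSpec k F))).comap (torusChart k F σ) ↔
        IsMonomial (k := k) (affineIdeal (ι k F σ) I) := by
    intro σ
    rw [affineIdeal, ← comap_chartAction_eq_iff, ← Scheme.IdealSheafData.comap_comp,
      ← Scheme.IdealSheafData.comap_comp, ← Scheme.IdealSheafData.comap_comp,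
      ← Scheme.IdealSheafData.comap_comp, chart_action, pullback.lift_snd]
  constructor
  · intro h σ
    rw [← hj, h]
  · intro h
    refine eq_of_openCover
      ((chartCover k F).pullback₁ (pullback.snd (torusToSpec k n) (toSpec k F))) fun (σ : F.cones) => ?_
    have hσ := (hj σ).2 (h σ)
    -- The cover of `T × X` has members `(T × X) ×_X U_σ`; the equality known on `T × U_σ` is
    -- transported to them along `g`.
    let g : pullback (pullback.snd (torusToSpec k n) (toSpec k F)) (ι k F σ) ⟶
        pullback (torusToSpec k n) (chartToSpec k σ.1) :=
      pullback.lift (pullback.fst _ _ ≫ pullback.fst _ _) (pullback.snd _ (ι k F σ))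
        (by rw [Category.assoc, pullback.condition, pullback.condition_assoc, ι_toSpec])
    have hg : g ≫ torusChart k F σ =
        pullback.fst (pullback.snd (torusToSpec k n) (toSpec k F)) (ι k F σ) := by
      apply pullback.hom_ext
      · rw [Category.assoc, pullback.lift_fst, pullback.lift_fst_assoc, Category.comp_id]
      · rw [Category.assoc, pullback.lift_snd, pullback.lift_snd_assoc, pullback.condition]
    have := congrArg (·.comap g) hσ
    simp only [← Scheme.IdealSheafData.comap_comp _ g, hg] at this
    exact this

end Invariance

/-! ### Sums of ideals of effective divisors. -/

section Divisors

variable {Y : Scheme.{u}} {J : Type u}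

/-- The ideal sheaf `𝒪(-∑ eᵢ Dᵢ)`. -/
def divisorIdeal (D : J → Closeds Y) (e : J →₀ ℕ) : Y.IdealSheafData :=
  e.prod fun i a => Scheme.IdealSheafData.vanishingIdeal (D i) ^ a

/-- The sum of the ideal sheaves `𝒪(-∑ eᵢ Dᵢ)`, `e ∈ S`. -/
def sumIdeal (D : J → Closeds Y) (S : Set (J →₀ ℕ)) : Y.IdealSheafData :=
  ⨆ e : S, divisorIdeal D e

lemma ideal_prod (s : Finset J) (I : J → Y.IdealSheafData) (U : Y.affineOpens) :
    (∏ i ∈ s, I i).ideal U = ∏ i ∈ s, (I i).ideal U := by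
  classical
  induction s using Finset.induction_on with
  | empty =>
    rw [Finset.prod_empty, Finset.prod_empty, Scheme.IdealSheafData.one_eq_top, Ideal.one_eq_top]
    rfl
  | insert a s ha ih =>
    rw [Finset.prod_insert ha, Finset.prod_insert ha, Scheme.IdealSheafData.ideal_mul,
      Pi.mul_apply, ih]

lemma ideal_sumIdeal (D : J → Closeds Y) (S : Set (J →₀ ℕ)) (U : Y.affineOpens) :
    (sumIdeal D S).ideal U = ⨆ m ∈ S, m.prod fun i e =>
      (Scheme.IdealSheafData.vanishingIdeal (D i)).ideal U ^ e := by
  rw [sumIdeal, Scheme.IdealSheafData.ideal_iSup, iSup_apply, iSup_subtype]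
  refine iSup_congr fun m => iSup_congr fun _ => ?_
  rw [divisorIdeal, Finsupp.prod, ideal_prod]
  rfl

lemma isToroidal_iff (D : J → Closeds Y) (I : Y.IdealSheafData) :
    IsToroidal D I ↔ ∀ y, ∃ S, AgreeAt I (sumIdeal D S) y := by
  refine forall_congr' fun y => ⟨?_, ?_⟩
  · rintro ⟨U, hy, S, h⟩
    exact ⟨S, U, hy, h.trans (ideal_sumIdeal D S U).symm⟩
  · rintro ⟨S, U, hy, h⟩
    exact ⟨U, hy, S, h.trans (ideal_sumIdeal D S U)⟩

lemma divisorIdeal_zero (D : J → Closeds Y) : divisorIdeal D 0 = ⊤ := rfl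

lemma divisorIdeal_add (D : J → Closeds Y) (e e' : J →₀ ℕ) :
    divisorIdeal D (e + e') = divisorIdeal D e * divisorIdeal D e' := by
  classical
  exact Finsupp.prod_add_index' (fun _ => pow_zero _) (fun _ _ _ => pow_add _ _ _)

lemma divisorIdeal_single (D : J → Closeds Y) (i : J) :
    divisorIdeal D (Finsupp.single i 1) = Scheme.IdealSheafData.vanishingIdeal (D i) := by
  exact (Finsupp.prod_single_index
    (h := fun i a => Scheme.IdealSheafData.vanishingIdeal (D i) ^ a) (pow_zero _)).trans
    (pow_one (Scheme.IdealSheafData.vanishingIdeal (D i)))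

end Divisors

/-! ### Boundary divisors and the equivalence of monomial and toroidal. -/

variable {k : Type u} [Field k] {n : ℕ} {F : Fan n}

lemma closure_singleton_subset_boundary {z : X k F} (hz : z ∈ boundary k F) :
    closure {z} ⊆ boundary k F :=
  closure_minimal (Set.singleton_subset_iff.2 hz) (isClosed_boundary k F)

/-- The closure of `w` is an irreducible subset of the boundary containing `D`, so maximality of `D`
makes them equal. -/
lemma BoundaryDivisor.mem_of_specializes (D : BoundaryDivisor k F) {z w : X k F}
    (hD : (D.1 : Set (X k F)) = closure {z}) (hw : w ∈ boundary k F) (h : w ⤳ z) : w ∈ D.1 := by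
  have hle : D.1 ≤ Closeds.closure {w} := by
    rw [← SetLike.coe_subset_coe, hD]
    exact closure_minimal (Set.singleton_subset_iff.2 h.mem_closure) isClosed_closure
  have := D.2.2 (y := Closeds.closure {w})
    ⟨isIrreducible_singleton.closure, closure_singleton_subset_boundary hw⟩ hle
  exact this (subset_closure (Set.mem_singleton w))

/-- The ideals of the boundary divisors are monomial on the charts. -/
lemma isMonomial_vanishingIdeal (D : BoundaryDivisor k F) (σ : F.cones) :
    IsMonomial (k := k) (affineIdeal (ι k F σ) (Scheme.IdealSheafData.vanishingIdeal D.1)) := by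
  obtain ⟨z, hz⟩ := QuasiSober.sober D.2.1.1 D.1.isClosed
  have hz : closure {z} = (D.1 : Set (X k F)) := hz
  have hmem : ∀ w, w ∈ D.1 ↔ z ⤳ w := fun w => by
    rw [specializes_iff_mem_closure, hz]
    rfl
  by_cases hne : ∃ p, ι k F σ p ∈ D.1
  · obtain ⟨p, hp⟩ := hne
    obtain ⟨q, rfl⟩ := exists_of_specializes ((hmem _).1 hp)
    have hq : affineIdeal (ι k F σ) (Scheme.IdealSheafData.vanishingIdeal D.1) = q.asIdeal := by
      ext r
      rw [mem_affineIdeal_vanishingIdeal]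
      simp only [hmem, ι_specializes_iff]
      exact ⟨fun h => h q le_rfl, fun h p hp => hp h⟩
    have hzb : ι k F σ q ∈ boundary k F := D.2.1.2 ((hmem _).2 specializes_rfl)
    have := q.2
    -- The monomial part of the prime `q` of `D` is prime and still contains a monomial, so it is a
    -- generization of `q` inside the boundary; maximality of `D` forces `q' = q`.
    let q' : chart k σ.1 := (⟨_, monomialPart_isPrime q.asIdeal⟩ : PrimeSpectrum (CoordRing k σ.1))
    have hle : q'.asIdeal ≤ q.asIdeal := monomialIdeal_le.2 fun m hm => hm
    have hq'b : ι k F σ q' ∈ boundary k F := by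
      obtain ⟨m, hm⟩ := ι_mem_boundary_iff.1 hzb
      exact ι_mem_boundary_iff.2 ⟨m, single_mem_monomialIdeal.2 ⟨m, hm, 0, (zero_add m).symm⟩⟩
    have hq'D := D.mem_of_specializes hz.symm hq'b (ι_specializes_iff.2 hle)
    rw [hmem, ι_specializes_iff] at hq'D
    rw [hq, le_antisymm hq'D hle]
    exact isMonomial_monomialIdeal _
  · have : affineIdeal (ι k F σ) (Scheme.IdealSheafData.vanishingIdeal D.1) = ⊤ := by
      rw [Ideal.eq_top_iff_one, mem_affineIdeal_vanishingIdeal]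
      exact fun p hp => (hne ⟨p, hp⟩).elim
    rw [this]
    exact IsMonomial.top

/-- The family of boundary divisors of a toric variety. -/
abbrev boundaryDivisors (k : Type u) [Field k] {n : ℕ} (F : Fan n) :
    BoundaryDivisor k F → Closeds (X k F) := fun D => D.1

lemma isMonomial_sumIdeal (S : Set (BoundaryDivisor k F →₀ ℕ)) (σ : F.cones) :
    IsMonomial (k := k) (affineIdeal (ι k F σ) (sumIdeal (boundaryDivisors k F) S)) := by
  rw [sumIdeal, affineIdeal_iSup]
  refine IsMonomial.iSup fun e => ?_
  rw [divisorIdeal, Finsupp.prod, affineIdeal_prod]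
  refine Finset.prod_induction _ (IsMonomial (k := k)) (fun _ _ h h' => h.mul h')
    (Ideal.one_eq_top (R := CoordRing k σ.1) ▸ IsMonomial.top) fun D _ => ?_
  rw [affineIdeal_pow]
  exact (isMonomial_vanishingIdeal D σ).pow _

/-- Ideal sheaves which are monomial on the chart `U_σ` agree on `U_σ` if they agree at a point
of its closed orbit. -/
lemma affineIdeal_eq_of_agreeAt {σ : F.cones} {I I' : (X k F).IdealSheafData}
    (hI : IsMonomial (k := k) (affineIdeal (ι k F σ) I))
    (hI' : IsMonomial (k := k) (affineIdeal (ι k F σ) I')) {q : chart k σ.1}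
    (hq : nonunitIdeal k (dualMonoid σ.1) ≤ q.asIdeal) (h : AgreeAt I I' (ι k F σ q)) :
    affineIdeal (ι k F σ) I = affineIdeal (ι k F σ) I' :=
  le_antisymm (hI.le_of_forall_exists hI' hq fun _ hf => h.exists_mul_mem _ hf)
    (hI'.le_of_forall_exists hI hq fun _ hf => h.symm.exists_mul_mem _ hf)

/-- Toroidal ideal sheaves are monomial on the charts. -/
lemma isMonomial_of_isToroidal {I : (X k F).IdealSheafData}
    (h : IsToroidal (boundaryDivisors k F) I) (σ : F.cones) :
    IsMonomial (k := k) (affineIdeal (ι k F σ) I) := by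
  rw [isToroidal_iff] at h
  obtain ⟨S, hS⟩ := h (ι k F σ (orbitPoint k F σ))
  have heq : affineIdeal (ι k F σ) I = affineIdeal (ι k F σ) (sumIdeal (boundaryDivisors k F) S) := by
    rw [affineIdeal_eq_iff]
    intro q
    obtain ⟨τ, hle, p, hp, hnu⟩ := exists_le_nonunitIdeal_le k F q
    obtain ⟨S', hS'⟩ := h (ι k F σ q)
    rw [← hp] at hS' ⊢
    have hgen : ι k F τ (orbitPoint k F τ) ⤳ ι k F τ p := ι_specializes_iff.2 hnu
    -- The generic point of the closed orbit of `U_τ` specializes both to the generic point of the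
    -- closed orbit of `U_σ` and to the given point. Hence the models `S` and `S'` agree there, and
    -- being monomial they agree on all of `U_τ`.
    have h1 := hS.of_specializes (orbitPoint_specializes k F hle)
    have h2 := (hS'.of_specializes hgen).symm.trans h1
    have h3 := affineIdeal_eq_of_agreeAt (isMonomial_sumIdeal S' τ) (isMonomial_sumIdeal S τ)
      (q := orbitPoint k F τ) le_rfl h2
    exact hS'.trans ((affineIdeal_eq_iff _).1 h3 p)
  rw [heq]
  exact isMonomial_sumIdeal S σ

/-- Split `m` into summands of smaller length; a prime ideal containing the product of the monomials
contains one of them. -/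
lemma exists_addIrreducible_single_mem {P : Type*} [AddCommMonoid P] (ℓ : P →+ ℕ)
    (hℓ : ∀ m, ℓ m = 0 → IsAddUnit m) (q : Ideal (AddMonoidAlgebra k P)) [hq : q.IsPrime] {m : P}
    (hm : AddMonoidAlgebra.single m 1 ∈ q) :
    ∃ h, AddIrreducible h ∧ AddMonoidAlgebra.single h 1 ∈ q := by
  induction hN : ℓ m using Nat.strong_induction_on generalizing m with
  | _ N ih =>
    have hu : ¬ IsAddUnit m := fun hu => hq.ne_top (q.eq_top_of_isUnit_mem hm (isUnit_single hu))
    rcases addIrreducible_or_factor hu with hm' | ⟨a, b, ha, hb, rfl⟩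
    · exact ⟨m, hm', hm⟩
    have e₁ : ℓ a ≠ 0 := fun h => ha (hℓ _ h)
    have e₂ : ℓ b ≠ 0 := fun h => hb (hℓ _ h)
    rw [map_add] at hN
    rw [← mul_one (1 : k), ← AddMonoidAlgebra.single_mul_single] at hm
    rcases hq.mem_or_mem hm with h | h
    · exact ih (ℓ a) (by omega) h rfl
    · exact ih (ℓ b) (by omega) h rfl

/-- On a smooth toric variety, an irreducible character is an equation of a boundary divisor. -/
lemma exists_boundaryDivisor (hX : Smooth (toSpec k F)) {σ : F.cones} {h : dualMonoid σ.1}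
    (hh : AddIrreducible h) : ∃ D : BoundaryDivisor k F,
      affineIdeal (ι k F σ) (Scheme.IdealSheafData.vanishingIdeal D.1) = monomialIdeal k {h} := by
  obtain ⟨ℓ, hℓ⟩ := exists_length (F.rational _ σ.2)
  have := formallySmooth_coordRing k F hX σ
  -- The primality criterion requires a set of exponents closed under adding arbitrary elements.
  have hspan : monomialIdeal k {h} = monomialIdeal k {m | ∃ d, m = h + d} := by
    refine le_antisymm (monomialIdeal_le.2 ?_) (monomialIdeal_le.2 ?_)
    · rintro _ rfl
      exact single_mem_monomialIdeal.2 ⟨_, ⟨0, (add_zero _).symm⟩, 0, (zero_add _).symm⟩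
    · rintro _ ⟨d, rfl⟩
      exact single_mem_monomialIdeal.2 ⟨h, rfl, d, add_comm _ _⟩
  have hprime : (monomialIdeal k {h}).IsPrime := by
    rw [hspan]
    refine monomialIdeal_isPrime ?_ ?_ ?_
    · rintro ⟨d, hd⟩
      exact hh.not_isAddUnit (IsAddUnit.of_add_eq_zero d hd.symm)
    · rintro _ ⟨d, rfl⟩ e
      exact ⟨e + d, add_left_comm _ _ _⟩
    · rintro a b ⟨c, hc⟩
      exact exists_eq_add_of_addIrreducible (k := k) ℓ hℓ hh hc
  let q : chart k σ.1 := (⟨_, hprime⟩ : PrimeSpectrum (CoordRing k σ.1))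
  have hq : ι k F σ q ∈ boundary k F :=
    ι_mem_boundary_iff.2 ⟨h, single_mem_monomialIdeal.2 ⟨h, rfl, 0, (zero_add h).symm⟩⟩
  have hmax : Maximal (fun Z : Closeds (X k F) =>
      IsIrreducible (Z : Set (X k F)) ∧ (Z : Set (X k F)) ⊆ boundary k F)
      (Closeds.closure {ι k F σ q}) := by
    refine ⟨⟨isIrreducible_singleton.closure, closure_singleton_subset_boundary hq⟩, ?_⟩
    intro Z hZ hle
    obtain ⟨w, hw⟩ := QuasiSober.sober hZ.1 Z.isClosed
    have hw : closure {w} = (Z : Set (X k F)) := hw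
    have hsp : w ⤳ ι k F σ q := by
      rw [specializes_iff_mem_closure, hw]
      exact hle (subset_closure (Set.mem_singleton _))
    obtain ⟨p, rfl⟩ := exists_of_specializes hsp
    have hpq := ι_specializes_iff.1 hsp
    obtain ⟨m, hm⟩ := ι_mem_boundary_iff.1 (hZ.2 (hw ▸ subset_closure (Set.mem_singleton _)))
    have := p.2
    -- The generic point `p` of a larger irreducible subset of the boundary contains an irreducible
    -- monomial `g`. As `p ⊆ q = (χ^h)`, `h` divides `g`, so they differ by a unit and `p = q`.
    obtain ⟨g, hg, hgp⟩ := exists_addIrreducible_single_mem ℓ hℓ p.asIdeal hm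
    obtain ⟨_, rfl, d, rfl⟩ := single_mem_monomialIdeal.1 (hpq hgp)
    have hd : IsAddUnit d := (hg.isAddUnit_or_isAddUnit rfl).resolve_right hh.not_isAddUnit
    have hqp : q.asIdeal ≤ p.asIdeal := by
      refine monomialIdeal_le.2 ?_
      rintro _ rfl
      rw [← mul_one (1 : k), ← AddMonoidAlgebra.single_mul_single] at hgp
      exact (Ideal.unit_mul_mem_iff_mem _ (isUnit_single hd)).1 hgp
    rw [← SetLike.coe_subset_coe, ← hw]
    exact closure_minimal (Set.singleton_subset_iff.2
      (ι_specializes_iff.2 hqp).mem_closure) isClosed_closure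
  refine ⟨⟨_, hmax⟩, ?_⟩
  ext r
  rw [mem_affineIdeal_vanishingIdeal]
  have hmem : ∀ p : chart k σ.1, ι k F σ p ∈ Closeds.closure {ι k F σ q} ↔
      q.asIdeal ≤ p.asIdeal := fun p => by
    rw [← ι_specializes_iff, specializes_iff_mem_closure]
    rfl
  simp only [hmem]
  exact ⟨fun h => h q le_rfl, fun h p hp => hp h⟩

/-- On a smooth toric variety, every character of a chart is an equation of a sum of
boundary divisors. -/
lemma exists_divisorIdeal (hX : Smooth (toSpec k F)) {σ : F.cones} (m : dualMonoid σ.1) :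
    ∃ e, affineIdeal (ι k F σ) (divisorIdeal (boundaryDivisors k F) e) = monomialIdeal k {m} := by
  obtain ⟨ℓ, hℓ⟩ := exists_length (F.rational _ σ.2)
  induction hN : ℓ m using Nat.strong_induction_on generalizing m with
  | _ N ih =>
    by_cases hu : IsAddUnit m
    · refine ⟨0, ?_⟩
      rw [divisorIdeal_zero, affineIdeal_top, monomialIdeal_singleton_of_isAddUnit hu]
    rcases addIrreducible_or_factor hu with hm | ⟨a, b, ha, hb, rfl⟩
    · obtain ⟨D, hD⟩ := exists_boundaryDivisor hX hm
      exact ⟨Finsupp.single D 1, by rw [divisorIdeal_single, hD]⟩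
    have e₁ : ℓ a ≠ 0 := fun h => ha (hℓ _ h)
    have e₂ : ℓ b ≠ 0 := fun h => hb (hℓ _ h)
    rw [map_add] at hN
    obtain ⟨e, he⟩ := ih (ℓ a) (by omega) a rfl
    obtain ⟨e', he'⟩ := ih (ℓ b) (by omega) b rfl
    refine ⟨e + e', ?_⟩
    rw [divisorIdeal_add, affineIdeal_mul, he, he', monomialIdeal_singleton_add]

/-- On a smooth toric variety, ideal sheaves which are monomial on the charts are toroidal. -/
lemma isToroidal_of_isMonomial (hX : Smooth (toSpec k F)) {I : (X k F).IdealSheafData}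
    (h : ∀ σ, IsMonomial (k := k) (affineIdeal (ι k F σ) I)) :
    IsToroidal (boundaryDivisors k F) I := by
  rw [isToroidal_iff]
  intro y
  obtain ⟨σ, q, rfl⟩ := exists_chart k F y
  -- All divisor ideals contained in `I` on the chart are taken; every monomial of `I` generates one
  -- of them, so their sum is `I`.
  let S : Set (BoundaryDivisor k F →₀ ℕ) :=
    {e | affineIdeal (ι k F σ) (divisorIdeal (boundaryDivisors k F) e) ≤ affineIdeal (ι k F σ) I}
  refine ⟨S, (affineIdeal_eq_iff (ι k F σ)).1 ?_ q⟩
  rw [sumIdeal, affineIdeal_iSup]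
  refine le_antisymm ?_ (iSup_le fun e => e.2)
  rw [(h σ).eq, monomialIdeal_le]
  intro m hm
  obtain ⟨e, he⟩ := exists_divisorIdeal hX m
  have heS : e ∈ S := by
    rw [Set.mem_ofPred_eq, he, monomialIdeal_le]
    rintro _ rfl
    exact hm
  refine Ideal.mem_iSup_of_mem (⟨e, heS⟩ : S) ?_
  rw [he]
  exact single_mem_monomialIdeal.2 ⟨m, rfl, 0, (zero_add m).symm⟩

end Toric

end

theorem mainTheorem10 (k : Type u) [Field k] (n : ℕ) (F : Toric.Fan n)
    (hX : Smooth (Toric.toSpec k F)) (I : (Toric.X k F).IdealSheafData) :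
    Toric.IsToric k F I ↔
      IsToroidal (fun D : Toric.BoundaryDivisor k F => D.1) I := by
  rw [Toric.isToric_iff]
  exact ⟨Toric.isToroidal_of_isMonomial hX, Toric.isMonomial_of_isToroidal⟩
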